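/- Let $0<k<1$ and let $\mathrm{sn},\mathrm{cn},\mathrm{dn}$ be the Jacobi elliptic functions of modulus $k$, $K=K(k)$ the complete elliptic integral of the first kind, $K'=K(\sqrt{1-k^2})$ and $q=\exp(-\pi K'/K)$. Let $w$ be a nonzero real number satisfying the genericity condition $w\neq 4KM_1/M_2$ for all nonzero integers $M_1,M_2$. For $0\le j\le n$ put $E^n_j=\prod_{s=0}^{j-1}\frac{\mathrm{sn}(w(n-s))}{\mathrm{sn}(w(s+1))}$, and let $\Phi_n^{(C)}(z)=\sum_{s=0}^n W_{ns}z^s$, where $W_{ns}=(-1)^s\,\mathrm{dn}(w(n-s))\,E^n_s$ if $n$ is even and $W_{ns}=(-1)^{s+1}\,\mathrm{cn}(w(n-s))\,E^n_s$ if $n$ is odd. Then: 1. Each $\Phi_n^{(C)}$ is monic of degree $n$, and $\Phi_0^{(C)}=1$. With $a_{2n}=\mathrm{cn}(w(2n+1))$ and $a_{2n+1}=-\mathrm{dn}(w(2n+2))$, the numbers $a_n\in(-1,1)$ are the reflection parameters of these polynomials: for all $n\ge 0$, $a_n=-\Phi_{n+1}^{(C)}(0)$ and $\Phi_{n+1}^{(C)}(z)=z\Phi_n^{(C)}(z)-a_n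 z^n\Phi_n^{(C)}(1/z)$. 2. For $s\in\mathbb Z$ put $z_s=\exp(i\pi w(s-\tfrac12)/K)$ and $\rho_s=\frac{\pi}{kK}\,\frac{1}{q^{s-1/2}+q^{-s+1/2}}$. The points $z_s$ are pairwise distinct and lie on the unit circle, $\rho_s>0$, and the polynomials are orthogonal with respect to the discrete measure with mass $\rho_s$ at $z_s$: for all $n,m\ge 0$, $$\sum_{s=-\infty}^{\infty}\rho_s\,\Phi_n^{(C)}(z_s)\,\Phi_m^{(C)}(1/z_s)=h_n\,\delta_{nm},$$ with absolutely convergent sum, where $h_n=\mu_n\prod_{s=1}^n\mathrm{sn}^2(ws)>0$, $\mu_n=k^n$ for even $n$ and $\mu_n=k^{n-1}$ for odd $n$. 3. The points $z_s$, $s\in\mathbb Z$, are dense in the unit circle; in particular, for every $s$ and every $\varepsilon>0$ there is a point $z_{s'}\ne z_s$ with $|z_s-z_{s'}|<\varepsilon$. -/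

import Mathlib

open Polynomial

/-- Legendre's incomplete elliptic integral of the first kind
`F(φ, k) = ∫₀^φ dθ / √(1 - k² sin² θ)`, with modulus `k`. -/
noncomputable def ellipticF (k φ : ℝ) : ℝ :=
  ∫ θ in (0 : ℝ)..φ, 1 / Real.sqrt (1 - k ^ 2 * Real.sin θ ^ 2)

/-- The complete elliptic integral of the first kind `K(k) = F(π/2, k)`. -/
noncomputable def ellipticK (k : ℝ) : ℝ := ellipticF k (Real.pi / 2)

/-- Jacobi's amplitude `am(u, k)`: the inverse of `φ ↦ F(φ, k)`, which for `0 < k < 1` is a bijection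
of the real line (`ellipticF_bijective`). -/
noncomputable def jacobiAm (k u : ℝ) : ℝ := Function.invFun (ellipticF k) u

/-- For `0 < k < 1` the incomplete elliptic integral is a bijection of the real line, so that
`jacobiAm k` is its two-sided inverse. -/
theorem ellipticF_bijective (k : ℝ) (hk0 : 0 < k) (hk1 : k < 1) :
    Function.Bijective (ellipticF k) := by
  have hk2 : k ^ 2 < 1 := by nlinarith
  have hpos : ∀ θ : ℝ, 0 < 1 - k ^ 2 * Real.sin θ ^ 2 := fun θ => by
    nlinarith [Real.sin_sq_le_one θ, sq_nonneg (Real.sin θ), sq_nonneg k]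
  have hcont : Continuous fun θ : ℝ => 1 / Real.sqrt (1 - k ^ 2 * Real.sin θ ^ 2) := by
    refine continuous_const.div (by fun_prop) fun θ => ?_
    exact (Real.sqrt_pos.2 (hpos θ)).ne'
  have hge : ∀ θ : ℝ, 1 ≤ 1 / Real.sqrt (1 - k ^ 2 * Real.sin θ ^ 2) := fun θ => by
    rw [le_div_iff₀ (Real.sqrt_pos.2 (hpos θ)), one_mul, Real.sqrt_le_iff]
    refine ⟨zero_le_one, ?_⟩
    nlinarith [mul_nonneg (sq_nonneg k) (sq_nonneg (Real.sin θ))]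
  have hgap : ∀ a b : ℝ, a ≤ b → b - a ≤ ellipticF k b - ellipticF k a := fun a b hab => by
    unfold ellipticF
    rw [intervalIntegral.integral_interval_sub_left (hcont.intervalIntegrable _ _)
      (hcont.intervalIntegrable _ _)]
    have h := intervalIntegral.integral_mono_on (μ := MeasureTheory.volume) hab
      (continuous_const.intervalIntegrable _ _)
      (hcont.intervalIntegrable a b) (fun θ _ => hge θ)
    simpa using h
  have hF0 : ellipticF k 0 = 0 := by simp [ellipticF]
  have hFc : Continuous (ellipticF k) :=
    intervalIntegral.continuous_primitive (fun a b => hcont.intervalIntegrable a b) 0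
  constructor
  · refine StrictMono.injective fun a b hab => ?_
    have := hgap a b hab.le
    linarith
  · refine hFc.surjective ?_ ?_
    · refine Filter.tendsto_atTop_mono' _ ?_ Filter.tendsto_id
      filter_upwards [Filter.eventually_ge_atTop 0] with x hx
      have := hgap 0 x hx
      simp only [id]
      linarith
    · refine Filter.tendsto_atBot_mono' _ ?_ Filter.tendsto_id
      filter_upwards [Filter.eventually_le_atBot 0] with x hx
      have := hgap x 0 hx
      simp only [id]
      linarith

/-- The Jacobi elliptic function `sn(u, k) = sin am(u, k)`, for real `u`. -/
noncomputable def jacobiSn (k u : ℝ) : ℝ := Real.sin (jacobiAm k u)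

/-- The Jacobi elliptic function `cn(u, k) = cos am(u, k)`, for real `u`. -/
noncomputable def jacobiCn (k u : ℝ) : ℝ := Real.cos (jacobiAm k u)

/-- The Jacobi elliptic function `dn(u, k) = √(1 - k² sn²(u, k))`, for real `u`. -/
noncomputable def jacobiDn (k u : ℝ) : ℝ := Real.sqrt (1 - k ^ 2 * jacobiSn k u ^ 2)

/-- The elliptic nome `q = exp(-π K'/K)`, where `K' = K(k')` and `k'² = 1 - k²`. -/
noncomputable def ellipticNome (k : ℝ) : ℝ :=
  Real.exp (-Real.pi * ellipticK (Real.sqrt (1 - k ^ 2)) / ellipticK k)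

/-- The elliptic binomial coefficients
`E^n_j = ∏_{s=0}^{j-1} sn(w(n-s)) / sn(w(s+1))` for `0 ≤ j ≤ n`, and `0` otherwise. -/
noncomputable def ellipticBinom (k w : ℝ) (n j : ℕ) : ℝ :=
  if j ≤ n then
    ∏ s ∈ Finset.range j, jacobiSn k (w * ((n : ℝ) - (s : ℝ))) / jacobiSn k (w * ((s : ℝ) + 1))
  else 0

/-- The expansion coefficients `W_{ns}` of the cn-polynomials:
`(-1)^s dn(w(n-s)) E^n_s` for even `n` and `(-1)^{s+1} cn(w(n-s)) E^n_s` for odd `n`. -/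
noncomputable def cnCoeff (k w : ℝ) (n s : ℕ) : ℝ :=
  if Even n then (-1) ^ s * jacobiDn k (w * ((n : ℝ) - (s : ℝ))) * ellipticBinom k w n s
  else (-1) ^ (s + 1) * jacobiCn k (w * ((n : ℝ) - (s : ℝ))) * ellipticBinom k w n s

/-- The cn-polynomials `Φ_n^{(C)}(z) = ∑_{s=0}^n W_{ns} z^s`. -/
noncomputable def cnPoly (k w : ℝ) (n : ℕ) : ℝ[X] :=
  ∑ s ∈ Finset.range (n + 1), C (cnCoeff k w n s) * X ^ s

/-- `a : ℕ → ℝ` is the sequence of (real) reflection parameters of the sequence `Φ` of polynomials: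
`Φ_0 = 1`, `a_n = -Φ_{n+1}(0)`, and the Szegő recurrence `Φ_{n+1}(z) = z Φ_n(z) - a_n z^n Φ_n(1/z)`
holds for all `n`. -/
def IsReflectionParameters (Φ : ℕ → ℝ[X]) (a : ℕ → ℝ) : Prop :=
  Φ 0 = 1 ∧ ∀ n : ℕ, a n = -(Φ (n + 1)).eval 0 ∧
    Φ (n + 1) = X * Φ n - C (a n) * (Φ n).reflect n

/-- The spectral points `z_s = exp(iπ w (s - 1/2) / K)`, `s ∈ ℤ`. -/
noncomputable def cnPoint (k w : ℝ) (s : ℤ) : ℂ :=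
  Complex.exp (Complex.I * Real.pi * w * ((s : ℂ) - 1 / 2) / ellipticK k)

/-- The weights `ρ_s = (π / (k K)) / (q^{s-1/2} + q^{-s+1/2})`, `s ∈ ℤ`. -/
noncomputable def cnWeight (k : ℝ) (s : ℤ) : ℝ :=
  Real.pi / (k * ellipticK k) *
    (1 / (ellipticNome k ^ ((s : ℝ) - 1 / 2) + ellipticNome k ^ (-(s : ℝ) + 1 / 2)))

/-- The normalization constants `h_n = μ_n ∏_{s=1}^n sn²(ws)`, where `μ_n = k^n` for even `n` and
`μ_n = k^{n-1}` for odd `n`. -/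
noncomputable def cnNorm (k w : ℝ) (n : ℕ) : ℝ :=
  (if Even n then k ^ n else k ^ (n - 1)) * ∏ s ∈ Finset.Icc 1 n, jacobiSn k (w * (s : ℝ)) ^ 2

/-! ### Jacobi's functions on the real line: derivatives, parity, periods, zeros and signs. -/

section Elliptic

variable {k : ℝ}

/-! The measure has moments `cn(wm)`. The Fourier series `cn u = ∑ ρ_s exp(iπ(s-1/2)u/K)`, taken at
`u = wm`, reads `∑ ρ_s z_s^m = cn(wm)`. Orthogonality on the infinite set of points thus becomes a
statement about finite sums `∑ W_{ni} W_{mj} cn(w(i-j))`.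

For the finite part, let `G_n(x) = ∑_s W_{ns} cn(x+ws)` (`cnTransform`); the inner product of `Φ_n`
with `z^j` is `G_n(-wj)`. The Szegő recurrence for the coefficients (`cnCoeff_succ_succ`) follows
from the addition theorems. It carries over to `G_n`, and induction gives a closed product: a
constant times `sn(x) sn(x+w) ⋯ sn(x+w(n-1))` times `cn(x+wn)` or `dn(x+wn)` (`cnTransform_eq`). So
`G_n(-wj)` vanishes for `j < n` and equals `h_n` for `j = n`.

The Fourier coefficients of `cn` are classically found by moving a contour up to the poles on the
line of height `K'`. Here this is done with real integrals: the real and imaginary parts of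
`cn(u+iv)` satisfy the Cauchy–Riemann equations, so the cosine coefficient on the line of height `v`
is `cosh(αv)` times that on the real axis (`integral_cnRe_mul_cos`). Its limit as `v → K'` is `π/k`,
the contribution of the poles (`tendsto_integral_cnRe_mul_cos`).

Genericity enters twice: it keeps `sn(w(n+1))` away from zero, and it makes `w/(2K)` irrational, so
that the `z_s` form an infinite orbit of an irrational rotation, injective and dense. -/

theorem one_sub_sq_mul_sin_sq_pos (hk0 : 0 < k) (hk1 : k < 1) (θ : ℝ) :
    0 < 1 - k ^ 2 * Real.sin θ ^ 2 := by
  have hk2 : k ^ 2 < 1 := by nlinarith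
  nlinarith [Real.sin_sq_le_one θ, sq_nonneg (Real.sin θ), sq_nonneg k]

theorem continuous_ellipticF_integrand (hk0 : 0 < k) (hk1 : k < 1) :
    Continuous fun θ : ℝ => 1 / Real.sqrt (1 - k ^ 2 * Real.sin θ ^ 2) := by
  refine continuous_const.div (by fun_prop) fun θ => ?_
  exact (Real.sqrt_pos.2 (one_sub_sq_mul_sin_sq_pos hk0 hk1 θ)).ne'

theorem hasDerivAt_ellipticF (hk0 : 0 < k) (hk1 : k < 1) (φ : ℝ) :
    HasDerivAt (ellipticF k) (1 / Real.sqrt (1 - k ^ 2 * Real.sin φ ^ 2)) φ := by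
  have h := continuous_ellipticF_integrand hk0 hk1
  exact intervalIntegral.integral_hasDerivAt_right (h.intervalIntegrable _ _)
    (h.stronglyMeasurableAtFilter _ _) h.continuousAt

theorem ellipticF_zero : ellipticF k 0 = 0 := by simp [ellipticF]

theorem ellipticF_neg (φ : ℝ) : ellipticF k (-φ) = -ellipticF k φ := by
  unfold ellipticF
  have h := intervalIntegral.integral_comp_neg (a := 0) (b := φ)
    (fun θ : ℝ => 1 / Real.sqrt (1 - k ^ 2 * Real.sin θ ^ 2))
  simp only [Real.sin_neg, neg_sq, neg_zero] at h
  rw [h, intervalIntegral.integral_symm]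

/-- The integrand is `π`-periodic, so the increment over `π` is constant; at `-π/2` oddness
evaluates it as `2K`. -/
theorem ellipticF_add_pi (hk0 : 0 < k) (hk1 : k < 1) (φ : ℝ) :
    ellipticF k (φ + Real.pi) = ellipticF k φ + 2 * ellipticK k := by
  have hd : ∀ x, HasDerivAt (fun x => ellipticF k (x + Real.pi) - ellipticF k x) 0 x := fun x => by
    have h1 := (hasDerivAt_ellipticF hk0 hk1 (x + Real.pi)).comp_add_const x Real.pi
    refine (h1.sub (hasDerivAt_ellipticF hk0 hk1 x)).congr_deriv ?_
    simp
  have hc := is_const_of_deriv_eq_zero (fun x => (hd x).differentiableAt)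
    (fun x => (hd x).deriv) φ (-(Real.pi / 2))
  have h2 : -(Real.pi / 2) + Real.pi = Real.pi / 2 := by ring
  simp only [h2, ellipticF_neg] at hc
  unfold ellipticK
  linarith

theorem ellipticF_strictMono (hk0 : 0 < k) (hk1 : k < 1) : StrictMono (ellipticF k) := by
  refine strictMono_of_deriv_pos fun x => ?_
  rw [(hasDerivAt_ellipticF hk0 hk1 x).deriv]
  exact one_div_pos.2 (Real.sqrt_pos.2 (one_sub_sq_mul_sin_sq_pos hk0 hk1 x))

theorem ellipticK_pos (hk0 : 0 < k) (hk1 : k < 1) : 0 < ellipticK k := by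
  have := ellipticF_strictMono hk0 hk1 (show 0 < Real.pi / 2 by positivity)
  rwa [ellipticF_zero] at this

theorem jacobiAm_ellipticF (hk0 : 0 < k) (hk1 : k < 1) (φ : ℝ) :
    jacobiAm k (ellipticF k φ) = φ :=
  Function.leftInverse_invFun (ellipticF_bijective k hk0 hk1).1 φ

theorem ellipticF_jacobiAm (hk0 : 0 < k) (hk1 : k < 1) (u : ℝ) :
    ellipticF k (jacobiAm k u) = u :=
  Function.rightInverse_invFun (ellipticF_bijective k hk0 hk1).2 u

theorem jacobiAm_zero (hk0 : 0 < k) (hk1 : k < 1) : jacobiAm k 0 = 0 := by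
  simpa [ellipticF_zero] using jacobiAm_ellipticF hk0 hk1 0

theorem jacobiAm_ellipticK (hk0 : 0 < k) (hk1 : k < 1) :
    jacobiAm k (ellipticK k) = Real.pi / 2 := jacobiAm_ellipticF hk0 hk1 _

theorem jacobiAm_neg (hk0 : 0 < k) (hk1 : k < 1) (u : ℝ) : jacobiAm k (-u) = -jacobiAm k u := by
  rw [← jacobiAm_ellipticF hk0 hk1 (-jacobiAm k u), ellipticF_neg, ellipticF_jacobiAm hk0 hk1]

theorem jacobiAm_add_two_ellipticK (hk0 : 0 < k) (hk1 : k < 1) (u : ℝ) :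
    jacobiAm k (u + 2 * ellipticK k) = jacobiAm k u + Real.pi := by
  rw [← jacobiAm_ellipticF hk0 hk1 (jacobiAm k u + Real.pi), ellipticF_add_pi hk0 hk1,
    ellipticF_jacobiAm hk0 hk1]

theorem jacobiAm_strictMono (hk0 : 0 < k) (hk1 : k < 1) : StrictMono (jacobiAm k) := fun a b hab =>
  (ellipticF_strictMono hk0 hk1).lt_iff_lt.1 (by simpa [ellipticF_jacobiAm hk0 hk1] using hab)

theorem continuous_jacobiAm (hk0 : 0 < k) (hk1 : k < 1) : Continuous (jacobiAm k) :=
  (jacobiAm_strictMono hk0 hk1).monotone.continuous_of_surjective fun φ =>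
    ⟨_, jacobiAm_ellipticF hk0 hk1 φ⟩

theorem hasDerivAt_jacobiAm (hk0 : 0 < k) (hk1 : k < 1) (u : ℝ) :
    HasDerivAt (jacobiAm k) (jacobiDn k u) u := by
  have hp := Real.sqrt_pos.2 (one_sub_sq_mul_sin_sq_pos hk0 hk1 (jacobiAm k u))
  have h := HasDerivAt.of_local_left_inverse (continuous_jacobiAm hk0 hk1).continuousAt
    (hasDerivAt_ellipticF hk0 hk1 (jacobiAm k u)) (one_div_pos.2 hp).ne'
    (Filter.Eventually.of_forall fun v => ellipticF_jacobiAm hk0 hk1 v)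
  simpa [jacobiDn, jacobiSn] using h

theorem jacobiDn_pos (hk0 : 0 < k) (hk1 : k < 1) (u : ℝ) : 0 < jacobiDn k u :=
  Real.sqrt_pos.2 (one_sub_sq_mul_sin_sq_pos hk0 hk1 (jacobiAm k u))

theorem jacobiDn_sq (hk0 : 0 < k) (hk1 : k < 1) (u : ℝ) :
    jacobiDn k u ^ 2 = 1 - k ^ 2 * jacobiSn k u ^ 2 :=
  Real.sq_sqrt (one_sub_sq_mul_sin_sq_pos hk0 hk1 (jacobiAm k u)).le

theorem jacobiCn_sq (u : ℝ) : jacobiCn k u ^ 2 = 1 - jacobiSn k u ^ 2 :=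
  Real.cos_sq' _

theorem hasDerivAt_jacobiSn (hk0 : 0 < k) (hk1 : k < 1) (u : ℝ) :
    HasDerivAt (jacobiSn k) (jacobiCn k u * jacobiDn k u) u :=
  (hasDerivAt_jacobiAm hk0 hk1 u).sin

theorem hasDerivAt_jacobiCn (hk0 : 0 < k) (hk1 : k < 1) (u : ℝ) :
    HasDerivAt (jacobiCn k) (-jacobiSn k u * jacobiDn k u) u :=
  (hasDerivAt_jacobiAm hk0 hk1 u).cos

theorem hasDerivAt_jacobiDn (hk0 : 0 < k) (hk1 : k < 1) (u : ℝ) :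
    HasDerivAt (jacobiDn k) (-k ^ 2 * jacobiSn k u * jacobiCn k u) u := by
  have hp := jacobiDn_pos hk0 hk1 u
  have h := ((((hasDerivAt_jacobiSn hk0 hk1 u).pow 2).const_mul (k ^ 2)).const_sub 1).sqrt
    (one_sub_sq_mul_sin_sq_pos hk0 hk1 (jacobiAm k u)).ne'
  refine h.congr_deriv ?_
  change _ / (2 * jacobiDn k u) = _
  field_simp
  norm_num
  ring

theorem jacobiSn_zero (hk0 : 0 < k) (hk1 : k < 1) : jacobiSn k 0 = 0 := by
  simp [jacobiSn, jacobiAm_zero hk0 hk1]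

theorem jacobiCn_zero (hk0 : 0 < k) (hk1 : k < 1) : jacobiCn k 0 = 1 := by
  simp [jacobiCn, jacobiAm_zero hk0 hk1]

theorem jacobiDn_zero (hk0 : 0 < k) (hk1 : k < 1) : jacobiDn k 0 = 1 := by
  simp [jacobiDn, jacobiSn_zero hk0 hk1]

theorem jacobiSn_neg (hk0 : 0 < k) (hk1 : k < 1) (u : ℝ) : jacobiSn k (-u) = -jacobiSn k u := by
  simp [jacobiSn, jacobiAm_neg hk0 hk1]

theorem jacobiCn_neg (hk0 : 0 < k) (hk1 : k < 1) (u : ℝ) : jacobiCn k (-u) = jacobiCn k u := by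
  simp [jacobiCn, jacobiAm_neg hk0 hk1]

theorem jacobiDn_neg (hk0 : 0 < k) (hk1 : k < 1) (u : ℝ) : jacobiDn k (-u) = jacobiDn k u := by
  simp [jacobiDn, jacobiSn_neg hk0 hk1]

theorem jacobiSn_add_two_ellipticK (hk0 : 0 < k) (hk1 : k < 1) (u : ℝ) :
    jacobiSn k (u + 2 * ellipticK k) = -jacobiSn k u := by
  simp [jacobiSn, jacobiAm_add_two_ellipticK hk0 hk1, Real.sin_add_pi]

theorem jacobiCn_add_two_ellipticK (hk0 : 0 < k) (hk1 : k < 1) (u : ℝ) :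
    jacobiCn k (u + 2 * ellipticK k) = -jacobiCn k u := by
  simp [jacobiCn, jacobiAm_add_two_ellipticK hk0 hk1, Real.cos_add_pi]

theorem jacobiDn_add_two_ellipticK (hk0 : 0 < k) (hk1 : k < 1) (u : ℝ) :
    jacobiDn k (u + 2 * ellipticK k) = jacobiDn k u := by
  simp [jacobiDn, jacobiSn_add_two_ellipticK hk0 hk1]

theorem ellipticF_int_mul_pi (hk0 : 0 < k) (hk1 : k < 1) (m : ℤ) :
    ellipticF k (m * Real.pi) = 2 * ellipticK k * m := by
  induction m with
  | zero => simp [ellipticF_zero]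
  | succ n ih =>
    push_cast at ih ⊢
    rw [add_mul, one_mul, ellipticF_add_pi hk0 hk1, ih]; ring
  | pred n ih =>
    have h := ellipticF_add_pi hk0 hk1 ((-(n : ℝ) - 1) * Real.pi)
    push_cast at ih ⊢
    rw [show (-(n : ℝ) - 1) * Real.pi + Real.pi = -(n : ℝ) * Real.pi by ring, ih] at h
    linarith

theorem jacobiSn_eq_zero_iff (hk0 : 0 < k) (hk1 : k < 1) (u : ℝ) :
    jacobiSn k u = 0 ↔ ∃ m : ℤ, u = 2 * ellipticK k * m := by
  rw [jacobiSn, Real.sin_eq_zero_iff]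
  refine exists_congr fun m => ?_
  rw [← (ellipticF_strictMono hk0 hk1).injective.eq_iff, ellipticF_int_mul_pi hk0 hk1,
    ellipticF_jacobiAm hk0 hk1, eq_comm]

theorem continuous_jacobiSn (hk0 : 0 < k) (hk1 : k < 1) : Continuous (jacobiSn k) :=
  Real.continuous_sin.comp (continuous_jacobiAm hk0 hk1)

theorem continuous_jacobiCn (hk0 : 0 < k) (hk1 : k < 1) : Continuous (jacobiCn k) :=
  Real.continuous_cos.comp (continuous_jacobiAm hk0 hk1)

theorem continuous_jacobiDn (hk0 : 0 < k) (hk1 : k < 1) : Continuous (jacobiDn k) :=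
  continuous_iff_continuousAt.2 fun u => (hasDerivAt_jacobiDn hk0 hk1 u).continuousAt

theorem jacobiSn_pos (hk0 : 0 < k) (hk1 : k < 1) {u : ℝ} (h0 : 0 < u)
    (h1 : u < 2 * ellipticK k) : 0 < jacobiSn k u := by
  have ha := jacobiAm_strictMono hk0 hk1 h0
  have hb := jacobiAm_strictMono hk0 hk1 h1
  have h2 := jacobiAm_add_two_ellipticK hk0 hk1 0
  rw [jacobiAm_zero hk0 hk1] at ha h2
  rw [zero_add, zero_add] at h2
  exact Real.sin_pos_of_pos_of_lt_pi ha (h2 ▸ hb)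

theorem jacobiCn_pos (hk0 : 0 < k) (hk1 : k < 1) {u : ℝ} (h0 : -ellipticK k < u)
    (h1 : u < ellipticK k) : 0 < jacobiCn k u := by
  have ha := jacobiAm_strictMono hk0 hk1 h0
  have hb := jacobiAm_strictMono hk0 hk1 h1
  rw [jacobiAm_neg hk0 hk1, jacobiAm_ellipticK hk0 hk1] at ha
  rw [jacobiAm_ellipticK hk0 hk1] at hb
  exact Real.cos_pos_of_mem_Ioo ⟨ha, hb⟩

theorem jacobiSn_ellipticK (hk0 : 0 < k) (hk1 : k < 1) : jacobiSn k (ellipticK k) = 1 := by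
  simp [jacobiSn, jacobiAm_ellipticK hk0 hk1]

theorem jacobiCn_ellipticK (hk0 : 0 < k) (hk1 : k < 1) : jacobiCn k (ellipticK k) = 0 := by
  simp [jacobiCn, jacobiAm_ellipticK hk0 hk1]

theorem jacobiSn_sq_le_one (u : ℝ) : jacobiSn k u ^ 2 ≤ 1 := Real.sin_sq_le_one _

/-! ### Addition theorems and the bilinear identities drawn from them. -/

theorem jacobi_addition_denom_pos (hk0 : 0 < k) (hk1 : k < 1) (x y : ℝ) :
    0 < 1 - k ^ 2 * jacobiSn k x ^ 2 * jacobiSn k y ^ 2 := by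
  have hk2 : k ^ 2 < 1 := by nlinarith
  have h1 := mul_le_one₀ (jacobiSn_sq_le_one (k := k) x) (sq_nonneg (jacobiSn k y))
    (jacobiSn_sq_le_one y)
  nlinarith [sq_nonneg k]

/-- A quotient `f(x, c - x)` that is stationary in `x` takes the value it has at `x = c`. -/
theorem eq_of_hasDerivAt_zero {f : ℝ → ℝ → ℝ} (c : ℝ)
    (h : ∀ x, HasDerivAt (fun x => f x (c - x)) 0 x) (x y : ℝ) (hc : x + y = c) :
    f x y = f c 0 := by
  have := is_const_of_deriv_eq_zero (fun x => (h x).differentiableAt) (fun x => (h x).deriv) x c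
  rw [show y = c - x by linarith]
  simpa using this

/-- Along a line `x + y = c` the right-hand side has zero derivative, so it equals its value at `(c,
0)`, which is `sn c`. The formulas for `cn` and `dn` are obtained in the same way. -/
theorem jacobiSn_add (hk0 : 0 < k) (hk1 : k < 1) (x y : ℝ) :
    jacobiSn k (x + y) = (jacobiSn k x * jacobiCn k y * jacobiDn k y
      + jacobiSn k y * jacobiCn k x * jacobiDn k x) /
      (1 - k ^ 2 * jacobiSn k x ^ 2 * jacobiSn k y ^ 2) := by
  have h := eq_of_hasDerivAt_zero (f := fun x y => (jacobiSn k x * jacobiCn k y * jacobiDn k y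
      + jacobiSn k y * jacobiCn k x * jacobiDn k x) /
      (1 - k ^ 2 * jacobiSn k x ^ 2 * jacobiSn k y ^ 2)) (x + y) (fun t => ?_) x y rfl
  · simpa [jacobiSn_zero hk0 hk1, jacobiCn_zero hk0 hk1, jacobiDn_zero hk0 hk1] using h.symm
  · have hD := jacobi_addition_denom_pos hk0 hk1 t (x + y - t)
    have s1 := hasDerivAt_jacobiSn hk0 hk1 t
    have c1 := hasDerivAt_jacobiCn hk0 hk1 t
    have d1 := hasDerivAt_jacobiDn hk0 hk1 t
    have s2 := (hasDerivAt_jacobiSn hk0 hk1 (x + y - t)).comp_const_sub (x + y) t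
    have c2 := (hasDerivAt_jacobiCn hk0 hk1 (x + y - t)).comp_const_sub (x + y) t
    have d2 := (hasDerivAt_jacobiDn hk0 hk1 (x + y - t)).comp_const_sub (x + y) t
    have h := (((s1.mul c2).mul d2).add ((s2.mul c1).mul d1)).div
      (((((s1.pow 2).const_mul (k ^ 2)).mul (s2.pow 2))).const_sub 1) hD.ne'
    refine h.congr_deriv ?_
    have e1 := jacobiCn_sq (k := k) t
    have e2 := jacobiCn_sq (k := k) (x + y - t)
    have e3 := jacobiDn_sq hk0 hk1 t
    have e4 := jacobiDn_sq hk0 hk1 (x + y - t)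
    rw [div_eq_zero_iff]
    left
    simp only [Pi.mul_apply, Pi.add_apply, Pi.pow_apply, Nat.cast_ofNat]
    -- With the six function values as free variables, the vanishing of the quotient-rule numerator
    -- is a polynomial identity modulo the quadratic relations `e1`–`e4`.
    generalize jacobiSn k t = s at *
    generalize jacobiCn k t = c at *
    generalize jacobiDn k t = d at *
    generalize jacobiSn k (x + y - t) = S at *
    generalize jacobiCn k (x + y - t) = C at *
    generalize jacobiDn k (x + y - t) = D at *
    clear h s1 s2 c1 c2 d1 d2
    grind

theorem jacobiCn_add (hk0 : 0 < k) (hk1 : k < 1) (x y : ℝ) :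
    jacobiCn k (x + y) = (jacobiCn k x * jacobiCn k y
      - jacobiSn k x * jacobiSn k y * jacobiDn k x * jacobiDn k y) /
      (1 - k ^ 2 * jacobiSn k x ^ 2 * jacobiSn k y ^ 2) := by
  have h := eq_of_hasDerivAt_zero (f := fun x y => (jacobiCn k x * jacobiCn k y
      - jacobiSn k x * jacobiSn k y * jacobiDn k x * jacobiDn k y) /
      (1 - k ^ 2 * jacobiSn k x ^ 2 * jacobiSn k y ^ 2)) (x + y) (fun t => ?_) x y rfl
  · simpa [jacobiSn_zero hk0 hk1, jacobiCn_zero hk0 hk1, jacobiDn_zero hk0 hk1] using h.symm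
  · have hD := jacobi_addition_denom_pos hk0 hk1 t (x + y - t)
    have s1 := hasDerivAt_jacobiSn hk0 hk1 t
    have c1 := hasDerivAt_jacobiCn hk0 hk1 t
    have d1 := hasDerivAt_jacobiDn hk0 hk1 t
    have s2 := (hasDerivAt_jacobiSn hk0 hk1 (x + y - t)).comp_const_sub (x + y) t
    have c2 := (hasDerivAt_jacobiCn hk0 hk1 (x + y - t)).comp_const_sub (x + y) t
    have d2 := (hasDerivAt_jacobiDn hk0 hk1 (x + y - t)).comp_const_sub (x + y) t
    have h := ((c1.mul c2).sub (((s1.mul s2).mul d1).mul d2)).div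
      (((((s1.pow 2).const_mul (k ^ 2)).mul (s2.pow 2))).const_sub 1) hD.ne'
    refine h.congr_deriv ?_
    have e1 := jacobiCn_sq (k := k) t
    have e2 := jacobiCn_sq (k := k) (x + y - t)
    have e3 := jacobiDn_sq hk0 hk1 t
    have e4 := jacobiDn_sq hk0 hk1 (x + y - t)
    rw [div_eq_zero_iff]
    left
    simp only [Pi.mul_apply, Pi.sub_apply, Pi.pow_apply, Nat.cast_ofNat]
    generalize jacobiSn k t = s at *
    generalize jacobiCn k t = c at *
    generalize jacobiDn k t = d at *
    generalize jacobiSn k (x + y - t) = S at *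
    generalize jacobiCn k (x + y - t) = C at *
    generalize jacobiDn k (x + y - t) = D at *
    clear h s1 s2 c1 c2 d1 d2
    grind

theorem jacobiDn_add (hk0 : 0 < k) (hk1 : k < 1) (x y : ℝ) :
    jacobiDn k (x + y) = (jacobiDn k x * jacobiDn k y
      - k ^ 2 * jacobiSn k x * jacobiSn k y * jacobiCn k x * jacobiCn k y) /
      (1 - k ^ 2 * jacobiSn k x ^ 2 * jacobiSn k y ^ 2) := by
  have h := eq_of_hasDerivAt_zero (f := fun x y => (jacobiDn k x * jacobiDn k y
      - k ^ 2 * jacobiSn k x * jacobiSn k y * jacobiCn k x * jacobiCn k y) /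
      (1 - k ^ 2 * jacobiSn k x ^ 2 * jacobiSn k y ^ 2)) (x + y) (fun t => ?_) x y rfl
  · simpa [jacobiSn_zero hk0 hk1, jacobiCn_zero hk0 hk1, jacobiDn_zero hk0 hk1] using h.symm
  · have hD := jacobi_addition_denom_pos hk0 hk1 t (x + y - t)
    have s1 := hasDerivAt_jacobiSn hk0 hk1 t
    have c1 := hasDerivAt_jacobiCn hk0 hk1 t
    have d1 := hasDerivAt_jacobiDn hk0 hk1 t
    have s2 := (hasDerivAt_jacobiSn hk0 hk1 (x + y - t)).comp_const_sub (x + y) t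
    have c2 := (hasDerivAt_jacobiCn hk0 hk1 (x + y - t)).comp_const_sub (x + y) t
    have d2 := (hasDerivAt_jacobiDn hk0 hk1 (x + y - t)).comp_const_sub (x + y) t
    have h := ((d1.mul d2).sub ((((s1.const_mul (k ^ 2)).mul s2).mul c1).mul c2)).div
      (((((s1.pow 2).const_mul (k ^ 2)).mul (s2.pow 2))).const_sub 1) hD.ne'
    refine h.congr_deriv ?_
    have e1 := jacobiCn_sq (k := k) t
    have e2 := jacobiCn_sq (k := k) (x + y - t)
    have e3 := jacobiDn_sq hk0 hk1 t
    have e4 := jacobiDn_sq hk0 hk1 (x + y - t)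
    rw [div_eq_zero_iff]
    left
    simp only [Pi.mul_apply, Pi.sub_apply, Pi.pow_apply, Nat.cast_ofNat]
    generalize jacobiSn k t = s at *
    generalize jacobiCn k t = c at *
    generalize jacobiDn k t = d at *
    generalize jacobiSn k (x + y - t) = S at *
    generalize jacobiCn k (x + y - t) = C at *
    generalize jacobiDn k (x + y - t) = D at *
    clear h s1 s2 c1 c2 d1 d2
    grind

/-- Drives the step from even to odd degree in `cnTransform_eq`; `jacobiDn_add_sub_mul` drives the
step from odd to even, where its factor `k ^ 2` produces the jump in `μ_n`. -/
theorem jacobiCn_add_sub_mul (hk0 : 0 < k) (hk1 : k < 1) (x y : ℝ) :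
    jacobiCn k (x + y) - jacobiCn k y * jacobiCn k x =
      -jacobiSn k x * jacobiSn k y * jacobiDn k (x + y) := by
  have hD := (jacobi_addition_denom_pos hk0 hk1 x y).ne'
  have e1 := jacobiCn_sq (k := k) x
  have e2 := jacobiCn_sq (k := k) y
  have e3 := jacobiDn_sq hk0 hk1 x
  have e4 := jacobiDn_sq hk0 hk1 y
  rw [jacobiCn_add hk0 hk1, jacobiDn_add hk0 hk1]
  generalize jacobiSn k x = s at *
  generalize jacobiCn k x = c at *
  generalize jacobiDn k x = d at *
  generalize jacobiSn k y = S at *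
  generalize jacobiCn k y = C at *
  generalize jacobiDn k y = D at *
  field_simp
  grind

theorem jacobiDn_add_sub_mul (hk0 : 0 < k) (hk1 : k < 1) (x y : ℝ) :
    jacobiDn k (x + y) - jacobiDn k y * jacobiDn k x =
      -k ^ 2 * jacobiSn k x * jacobiSn k y * jacobiCn k (x + y) := by
  have hD := (jacobi_addition_denom_pos hk0 hk1 x y).ne'
  have e1 := jacobiCn_sq (k := k) x
  have e2 := jacobiCn_sq (k := k) y
  have e3 := jacobiDn_sq hk0 hk1 x
  have e4 := jacobiDn_sq hk0 hk1 y
  rw [jacobiCn_add hk0 hk1, jacobiDn_add hk0 hk1]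
  generalize jacobiSn k x = s at *
  generalize jacobiCn k x = c at *
  generalize jacobiDn k x = d at *
  generalize jacobiSn k y = S at *
  generalize jacobiCn k y = C at *
  generalize jacobiDn k y = D at *
  field_simp
  grind

/-- This and `jacobiDn_mul_jacobiSn_add` are the Szegő recurrence for the coefficients with the
common factorials removed, for even and odd degree respectively. -/
theorem jacobiCn_mul_jacobiSn_add (hk0 : 0 < k) (hk1 : k < 1) (x y : ℝ) :
    jacobiCn k y * jacobiSn k (x + y) =
      jacobiDn k y * jacobiSn k x + jacobiCn k (x + y) * jacobiDn k x * jacobiSn k y := by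
  have hD := (jacobi_addition_denom_pos hk0 hk1 x y).ne'
  have e1 := jacobiCn_sq (k := k) x
  have e2 := jacobiCn_sq (k := k) y
  have e3 := jacobiDn_sq hk0 hk1 x
  have e4 := jacobiDn_sq hk0 hk1 y
  rw [jacobiSn_add hk0 hk1, jacobiCn_add hk0 hk1]
  generalize jacobiSn k x = s at *
  generalize jacobiCn k x = c at *
  generalize jacobiDn k x = d at *
  generalize jacobiSn k y = S at *
  generalize jacobiCn k y = C at *
  generalize jacobiDn k y = D at *
  field_simp
  grind

theorem jacobiDn_mul_jacobiSn_add (hk0 : 0 < k) (hk1 : k < 1) (x y : ℝ) :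
    jacobiDn k y * jacobiSn k (x + y) =
      jacobiCn k y * jacobiSn k x + jacobiDn k (x + y) * jacobiCn k x * jacobiSn k y := by
  have hD := (jacobi_addition_denom_pos hk0 hk1 x y).ne'
  have e1 := jacobiCn_sq (k := k) x
  have e2 := jacobiCn_sq (k := k) y
  have e3 := jacobiDn_sq hk0 hk1 x
  have e4 := jacobiDn_sq hk0 hk1 y
  rw [jacobiSn_add hk0 hk1, jacobiDn_add hk0 hk1]
  generalize jacobiSn k x = s at *
  generalize jacobiCn k x = c at *
  generalize jacobiDn k x = d at *
  generalize jacobiSn k y = S at *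
  generalize jacobiCn k y = C at *
  generalize jacobiDn k y = D at *
  field_simp
  grind

end Elliptic

/-! ### The polynomials: Szegő recurrence, and orthogonality against the moments `cn(wm)`. -/

section CnPolynomials

variable {k w : ℝ}

/-- The elliptic factorial `[n]! = ∏_{s=1}^n sn(ws)`. -/
noncomputable def ellipticFactorial (k w : ℝ) (n : ℕ) : ℝ :=
  ∏ i ∈ Finset.range n, jacobiSn k (w * ((i : ℝ) + 1))

theorem ellipticFactorial_succ (n : ℕ) :
    ellipticFactorial k w (n + 1) = ellipticFactorial k w n * jacobiSn k (w * ((n : ℝ) + 1)) :=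
  Finset.prod_range_succ _ _

theorem ellipticFactorial_ne_zero (hs : ∀ n : ℕ, jacobiSn k (w * ((n : ℝ) + 1)) ≠ 0) (n : ℕ) :
    ellipticFactorial k w n ≠ 0 :=
  Finset.prod_ne_zero_iff.2 fun i _ => hs i

/-- Writing the upper index as `a + b` shows the symmetry between `a` and `b` and avoids truncated
subtraction. -/
theorem ellipticBinom_add (hs : ∀ n : ℕ, jacobiSn k (w * ((n : ℝ) + 1)) ≠ 0) (a b : ℕ) :
    ellipticBinom k w (a + b) a =
      ellipticFactorial k w (a + b) / (ellipticFactorial k w a * ellipticFactorial k w b) := by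
  have hb := ellipticFactorial_ne_zero hs b
  have ha := ellipticFactorial_ne_zero hs a
  rw [ellipticBinom, if_pos (Nat.le_add_right a b), Finset.prod_div_distrib,
    eq_div_iff (mul_ne_zero ha hb)]
  have h1 : ellipticFactorial k w (a + b) = ellipticFactorial k w b *
      ∏ s ∈ Finset.range a, jacobiSn k (w * (((a + b : ℕ) : ℝ) - (s : ℝ))) := by
    rw [add_comm a b, ellipticFactorial, Finset.prod_range_add,
      ← Finset.prod_range_reflect _ a, ellipticFactorial]
    congr 1
    refine Finset.prod_congr rfl fun j hj => ?_
    have hj' : j + 1 ≤ a := Finset.mem_range.1 hj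
    rw [show a - 1 - j = a - (j + 1) by omega]
    congr 2
    push_cast [Nat.cast_sub hj']
    ring
  rw [h1]
  change _ / ellipticFactorial k w a * _ = _
  field_simp

theorem cnCoeff_of_lt {n s : ℕ} (h : n < s) : cnCoeff k w n s = 0 := by
  simp [cnCoeff, ellipticBinom, not_le.2 h]

theorem cnCoeff_add (hs : ∀ n : ℕ, jacobiSn k (w * ((n : ℝ) + 1)) ≠ 0) (a b : ℕ) :
    cnCoeff k w (a + b) a =
      (if Even (a + b) then (-1) ^ a * jacobiDn k (w * b) else (-1) ^ (a + 1) * jacobiCn k (w * b)) *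
      (ellipticFactorial k w (a + b) / (ellipticFactorial k w a * ellipticFactorial k w b)) := by
  rw [cnCoeff, ellipticBinom_add hs, show ((a + b : ℕ) : ℝ) - (a : ℝ) = b by push_cast; ring]
  split_ifs <;> rfl

theorem cnCoeff_self (hk0 : 0 < k) (hk1 : k < 1)
    (hs : ∀ n : ℕ, jacobiSn k (w * ((n : ℝ) + 1)) ≠ 0) (n : ℕ) : cnCoeff k w n n = 1 := by
  have h := cnCoeff_add hs n 0
  have hn := ellipticFactorial_ne_zero hs n
  simp only [add_zero] at h
  rw [h, show ellipticFactorial k w 0 = 1 from rfl, mul_one, div_self hn, mul_one, Nat.cast_zero,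
    mul_zero, jacobiDn_zero hk0 hk1, jacobiCn_zero hk0 hk1]
  rcases Nat.even_or_odd n with he | ho
  · simp [he]
  · simp [Nat.not_even_iff_odd.2 ho, ho.add_one.neg_one_pow]

/-- The reflection parameters of the cn-polynomials. -/
noncomputable def cnReflection (k w : ℝ) (n : ℕ) : ℝ :=
  if Even n then jacobiCn k (w * ((n : ℝ) + 1)) else -jacobiDn k (w * ((n : ℝ) + 1))

theorem cnCoeff_succ_zero (hs : ∀ n : ℕ, jacobiSn k (w * ((n : ℝ) + 1)) ≠ 0) (n : ℕ) :
    cnCoeff k w (n + 1) 0 = -cnReflection k w n := by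
  have h := cnCoeff_add hs 0 (n + 1)
  have hn := ellipticFactorial_ne_zero hs (n + 1)
  simp only [zero_add] at h
  rw [h, show ellipticFactorial k w 0 = 1 from rfl, one_mul, div_self hn, cnReflection]
  rcases Nat.even_or_odd n with he | ho
  · simp [he, Nat.even_add_one]
  · simp [Nat.not_even_iff_odd.2 ho, Nat.even_add_one]

/-- Write `n = b + (s+1)`, `x = w(s+1)`, `y = w(b+1)`. After division by `[n]!/([s+1]! [b+1]!)` the
three binomials become `sn(x+y)`, `sn x` and `sn y`, which leaves one of the two identities `i1`,
`i2`, according to the parity of `n`. -/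
theorem cnCoeff_succ_succ (hk0 : 0 < k) (hk1 : k < 1)
    (hs : ∀ n : ℕ, jacobiSn k (w * ((n : ℝ) + 1)) ≠ 0) {n s : ℕ} (h : s + 1 ≤ n) :
    cnCoeff k w (n + 1) (s + 1) =
      cnCoeff k w n s - cnReflection k w n * cnCoeff k w n (n - (s + 1)) := by
  obtain ⟨b, rfl⟩ := Nat.exists_eq_add_of_le h
  have h1 := cnCoeff_add hs (s + 1) (b + 1)
  have h2 := cnCoeff_add hs s (b + 1)
  have h3 := cnCoeff_add hs b (s + 1)
  rw [show s + 1 + b + 1 = s + 1 + (b + 1) by ring, h1,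
    show s + 1 + b - (s + 1) = b by omega, show s + 1 + b = s + (b + 1) by ring, h2,
    show s + (b + 1) = b + (s + 1) by ring, h3]
  have f1 := ellipticFactorial_ne_zero hs s
  have f2 := ellipticFactorial_ne_zero hs b
  have f3 := ellipticFactorial_ne_zero hs (b + (s + 1))
  have g1 := hs s
  have g2 := hs b
  rw [show s + 1 + (b + 1) = b + (s + 1) + 1 by ring, ellipticFactorial_succ (b + (s + 1)),
    ellipticFactorial_succ s, ellipticFactorial_succ b, cnReflection]
  have i1 := jacobiCn_mul_jacobiSn_add hk0 hk1 (w * ((s : ℝ) + 1)) (w * ((b : ℝ) + 1))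
  have i2 := jacobiDn_mul_jacobiSn_add hk0 hk1 (w * ((s : ℝ) + 1)) (w * ((b : ℝ) + 1))
  have hN : w * ((s : ℝ) + 1) + w * ((b : ℝ) + 1) = w * (((b + (s + 1) : ℕ) : ℝ) + 1) := by
    push_cast; ring
  rw [hN] at i1 i2
  rw [show ((s + 1 : ℕ) : ℝ) = (s : ℝ) + 1 by push_cast; ring,
    show ((b + 1 : ℕ) : ℝ) = (b : ℝ) + 1 by push_cast; ring]
  rcases Nat.even_or_odd (b + (s + 1)) with he | ho
  · have hp : (-1 : ℝ) ^ b = (-1) ^ (s + 1) := neg_one_pow_congr (Nat.even_add.1 he)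
    simp only [he, if_true, Nat.even_add_one, not_true_eq_false, if_false, hp]
    field_simp
    simp only [pow_succ]
    linear_combination (-1 : ℝ) ^ s * i1
  · have he := Nat.not_even_iff_odd.2 ho
    have hp : (-1 : ℝ) ^ b = (-1) ^ s := neg_one_pow_congr (by
      rw [Nat.even_add, Nat.even_add_one] at he
      tauto)
    simp only [he, if_false, Nat.even_add_one, not_false_eq_true, if_true, hp]
    field_simp
    simp only [pow_succ, hp]
    linear_combination -(-1 : ℝ) ^ s * i2

theorem cnPoly_coeff (n s : ℕ) : (cnPoly k w n).coeff s = cnCoeff k w n s := by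
  simp only [cnPoly, finsetSum_coeff, coeff_C_mul, coeff_X_pow, mul_ite, mul_one, mul_zero,
    Finset.sum_ite_eq, Finset.mem_range]
  split_ifs with h
  · rfl
  · exact (cnCoeff_of_lt (by omega)).symm

theorem natDegree_cnPoly (hk0 : 0 < k) (hk1 : k < 1)
    (hs : ∀ n : ℕ, jacobiSn k (w * ((n : ℝ) + 1)) ≠ 0) (n : ℕ) :
    (cnPoly k w n).natDegree = n := by
  refine natDegree_eq_of_le_of_coeff_ne_zero (natDegree_le_iff_coeff_eq_zero.2 fun s hn => ?_) ?_
  · rw [cnPoly_coeff, cnCoeff_of_lt (by omega)]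
  · rw [cnPoly_coeff, cnCoeff_self hk0 hk1 hs]
    exact one_ne_zero

theorem monic_cnPoly (hk0 : 0 < k) (hk1 : k < 1)
    (hs : ∀ n : ℕ, jacobiSn k (w * ((n : ℝ) + 1)) ≠ 0) (n : ℕ) : (cnPoly k w n).Monic := by
  rw [Monic, leadingCoeff, natDegree_cnPoly hk0 hk1 hs, cnPoly_coeff, cnCoeff_self hk0 hk1 hs]

theorem isReflectionParameters_cnPoly (hk0 : 0 < k) (hk1 : k < 1)
    (hs : ∀ n : ℕ, jacobiSn k (w * ((n : ℝ) + 1)) ≠ 0) :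
    IsReflectionParameters (cnPoly k w) (cnReflection k w) := by
  refine ⟨?_, fun n => ⟨?_, ?_⟩⟩
  · simp [cnPoly, cnCoeff_self hk0 hk1 hs]
  · rw [← coeff_zero_eq_eval_zero, cnPoly_coeff, cnCoeff_succ_zero hs, neg_neg]
  · ext s
    rw [coeff_sub, coeff_C_mul, coeff_reflect, cnPoly_coeff, cnPoly_coeff]
    rcases s with _ | s
    · rw [revAt_le (Nat.zero_le n), cnCoeff_succ_zero hs, coeff_X_mul_zero, Nat.sub_zero,
        cnCoeff_self hk0 hk1 hs]
      ring
    · rw [coeff_X_mul, cnPoly_coeff]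
      rcases le_or_gt (s + 1) n with h | h
      · rw [revAt_le h, cnCoeff_succ_succ hk0 hk1 hs h]
      -- `revAt n` fixes indices above `n`, so the reflected polynomial contributes nothing here.
      -- Either `s = n`, with leading coefficients on both sides, or both sides are zero.
      · rw [revAt_eq_self_of_lt h, cnCoeff_of_lt h, mul_zero, sub_zero]
        rcases (Nat.lt_succ_iff.1 h).eq_or_lt with rfl | h'
        · rw [cnCoeff_self hk0 hk1 hs, cnCoeff_self hk0 hk1 hs]
        · rw [cnCoeff_of_lt h', cnCoeff_of_lt (by omega)]

/-- The value at `x` of the elliptic function `∑_s W_{ns} cn(x + ws)`. -/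
noncomputable def cnTransform (k w : ℝ) (n : ℕ) (x : ℝ) : ℝ :=
  ∑ s ∈ Finset.range (n + 1), cnCoeff k w n s * jacobiCn k (x + w * s)

/-- Apply the linear map `z^s ↦ cn(x+ws)` to the Szegő recurrence. Multiplication by `z` becomes `x
↦ x + w`, and since `cn` is even, reversal becomes `x ↦ -x - wn`. -/
theorem cnTransform_succ (hk0 : 0 < k) (hk1 : k < 1)
    (hs : ∀ n : ℕ, jacobiSn k (w * ((n : ℝ) + 1)) ≠ 0) (n : ℕ) (x : ℝ) :
    cnTransform k w (n + 1) x =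
      cnTransform k w n (x + w) - cnReflection k w n * cnTransform k w n (-x - w * n) := by
  have h1 : cnTransform k w n (-x - w * n) =
      ∑ s ∈ Finset.range (n + 1), cnCoeff k w n (n - s) * jacobiCn k (x + w * s) := by
    rw [cnTransform, ← Finset.sum_range_reflect _ (n + 1)]
    refine Finset.sum_congr rfl fun s hs => ?_
    have hs' : s ≤ n := Nat.lt_succ_iff.1 (Finset.mem_range.1 hs)
    rw [show n + 1 - 1 - s = n - s by omega, ← jacobiCn_neg hk0 hk1]
    congr 2
    push_cast [Nat.cast_sub hs']
    ring
  have h2 : cnTransform k w n (x + w) =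
      ∑ s ∈ Finset.range (n + 1), cnCoeff k w n s * jacobiCn k (x + w * ((s + 1 : ℕ) : ℝ)) := by
    refine Finset.sum_congr rfl fun s _ => ?_
    congr 2
    push_cast; ring
  have h3 : cnTransform k w (n + 1) x = ∑ s ∈ Finset.range n,
      cnCoeff k w (n + 1) (s + 1) * jacobiCn k (x + w * ((s + 1 : ℕ) : ℝ)) +
      jacobiCn k (x + w * ((n + 1 : ℕ) : ℝ)) - cnReflection k w n * jacobiCn k (x + w * (0 : ℕ)) := by
    rw [cnTransform, Finset.sum_range_succ', Finset.sum_range_succ, cnCoeff_succ_zero hs,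
      cnCoeff_self hk0 hk1 hs]
    ring
  rw [h3, h1, h2, Finset.sum_range_succ _ n,
    Finset.sum_range_succ' (fun s => cnCoeff k w n (n - s) * jacobiCn k (x + w * s)) n,
    Nat.sub_zero, cnCoeff_self hk0 hk1 hs,
    Finset.sum_congr rfl fun s hs' => by
      rw [cnCoeff_succ_succ hk0 hk1 hs (Nat.succ_le_of_lt (Finset.mem_range.1 hs')), sub_mul,
        mul_assoc],
    Finset.sum_sub_distrib, ← Finset.mul_sum]
  ring

/-- In the induction both terms share the product of `sn(x+w(j+1))` over `j < n`. What remains, with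
`y = w(n+1)`, is `cn(x+y) - cn y cn x` or its `dn` analogue, which supplies the missing factors `sn
x` and `sn y`. -/
theorem cnTransform_eq (hk0 : 0 < k) (hk1 : k < 1)
    (hs : ∀ n : ℕ, jacobiSn k (w * ((n : ℝ) + 1)) ≠ 0) (n : ℕ) (x : ℝ) :
    cnTransform k w n x = (-1) ^ n * (if Even n then k ^ n else k ^ (n - 1)) *
      ellipticFactorial k w n * (∏ j ∈ Finset.range n, jacobiSn k (x + w * j)) *
      (if Even n then jacobiCn k (x + w * n) else jacobiDn k (x + w * n)) := by
  induction n generalizing x with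
  | zero => simp [cnTransform, ellipticFactorial, cnCoeff_self hk0 hk1 hs]
  | succ n ih =>
    rw [cnTransform_succ hk0 hk1 hs, ih, ih]
    have p1 : ∏ j ∈ Finset.range n, jacobiSn k (x + w + w * j) =
        ∏ j ∈ Finset.range n, jacobiSn k (x + w * ((j + 1 : ℕ) : ℝ)) := by
      refine Finset.prod_congr rfl fun j _ => ?_
      congr 1; push_cast; ring
    have p2 : ∏ j ∈ Finset.range n, jacobiSn k (-x - w * n + w * j) =
        (-1) ^ n * ∏ j ∈ Finset.range n, jacobiSn k (x + w * ((j + 1 : ℕ) : ℝ)) := by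
      rw [← Finset.prod_range_reflect (fun j => jacobiSn k (x + w * ((j + 1 : ℕ) : ℝ)))]
      rw [show (-1 : ℝ) ^ n = ∏ _j ∈ Finset.range n, (-1) by simp, ← Finset.prod_mul_distrib]
      refine Finset.prod_congr rfl fun j hj => ?_
      have hj' : j + 1 ≤ n := Finset.mem_range.1 hj
      rw [neg_one_mul, ← jacobiSn_neg hk0 hk1, show n - 1 - j + 1 = n - j by omega]
      congr 1
      push_cast [Nat.cast_sub (show j ≤ n by omega)]
      ring
    rw [p1, p2, Finset.prod_range_succ', ellipticFactorial_succ, cnReflection]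
    generalize ∏ j ∈ Finset.range n, jacobiSn k (x + w * ((j + 1 : ℕ) : ℝ)) = A
    have e1 : x + w + w * n = x + w * ((n : ℝ) + 1) := by ring
    have e2 : -x - w * n + w * n = -x := by ring
    rw [e1, e2, jacobiCn_neg hk0 hk1, jacobiDn_neg hk0 hk1]
    have i1 := jacobiCn_add_sub_mul hk0 hk1 x (w * ((n : ℝ) + 1))
    have i2 := jacobiDn_add_sub_mul hk0 hk1 x (w * ((n : ℝ) + 1))
    push_cast
    rcases Nat.even_or_odd n with he | ho
    · simp only [he, if_true, Nat.even_add_one, not_true_eq_false, if_false, he.neg_one_pow,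
        he.add_one.neg_one_pow]
      simp only [mul_zero, add_zero]
      linear_combination k ^ n * ellipticFactorial k w n * A * i1
    · have hne := Nat.not_even_iff_odd.2 ho
      obtain ⟨m, rfl⟩ := ho
      simp only [hne, if_false, Nat.even_add_one, not_false_eq_true, if_true,
        pow_succ, Even.neg_one_pow (even_two_mul m), Nat.add_sub_cancel]
      simp only [mul_zero, add_zero]
      push_cast at i2 ⊢
      linear_combination -k ^ (2 * m) * ellipticFactorial k w (2 * m + 1) * A * i2

theorem cnNorm_eq (n : ℕ) : cnNorm k w n =
    (if Even n then k ^ n else k ^ (n - 1)) * ellipticFactorial k w n ^ 2 := by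
  have h : ∏ s ∈ Finset.Icc 1 n, jacobiSn k (w * (s : ℝ)) ^ 2 = ellipticFactorial k w n ^ 2 := by
    induction n with
    | zero => simp [ellipticFactorial]
    | succ n ih =>
      rw [Finset.prod_Icc_succ_top (by omega), ih, ellipticFactorial_succ, mul_pow]
      push_cast
      rfl
  rw [cnNorm, h]

theorem cnNorm_pos (hk0 : 0 < k) (hs : ∀ n : ℕ, jacobiSn k (w * ((n : ℝ) + 1)) ≠ 0) (n : ℕ) :
    0 < cnNorm k w n := by
  rw [cnNorm_eq]
  have := ellipticFactorial_ne_zero hs n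
  split_ifs <;> positivity

theorem cnTransform_neg_of_lt (hk0 : 0 < k) (hk1 : k < 1)
    (hs : ∀ n : ℕ, jacobiSn k (w * ((n : ℝ) + 1)) ≠ 0) {n j : ℕ} (h : j < n) :
    cnTransform k w n (-(w * j)) = 0 := by
  rw [cnTransform_eq hk0 hk1 hs, Finset.prod_eq_zero (Finset.mem_range.2 h)]
  · ring
  · rw [neg_add_cancel, jacobiSn_zero hk0 hk1]

/-- The `sn` factors become `-sn(wn), …, -sn(w)`: the factorial appears a second time, and the two
signs `(-1)^n` cancel. -/
theorem cnTransform_neg_self (hk0 : 0 < k) (hk1 : k < 1)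
    (hs : ∀ n : ℕ, jacobiSn k (w * ((n : ℝ) + 1)) ≠ 0) (n : ℕ) :
    cnTransform k w n (-(w * n)) = cnNorm k w n := by
  have h : ∏ j ∈ Finset.range n, jacobiSn k (-(w * n) + w * j) =
      (-1) ^ n * ellipticFactorial k w n := by
    rw [ellipticFactorial, ← Finset.prod_range_reflect (fun i : ℕ => jacobiSn k (w * ((i : ℝ) + 1)))]
    rw [show (-1 : ℝ) ^ n = ∏ _j ∈ Finset.range n, (-1) by simp, ← Finset.prod_mul_distrib]
    refine Finset.prod_congr rfl fun j hj => ?_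
    have hj' : j + 1 ≤ n := Finset.mem_range.1 hj
    rw [neg_one_mul, ← jacobiSn_neg hk0 hk1, show n - 1 - j = n - (j + 1) by omega]
    congr 1
    push_cast [Nat.cast_sub hj']
    ring
  rw [cnTransform_eq hk0 hk1 hs, h, neg_add_cancel, jacobiCn_zero hk0 hk1, jacobiDn_zero hk0 hk1,
    ite_self, cnNorm_eq]
  have : (-1 : ℝ) ^ n * (-1) ^ n = 1 := by rw [← mul_pow]; simp
  linear_combination (if Even n then k ^ n else k ^ (n - 1)) * ellipticFactorial k w n ^ 2 * this

/-- Orthogonality of the cn-polynomials with respect to the moments `cn(wm)`. -/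
theorem sum_cnCoeff_mul_jacobiCn (hk0 : 0 < k) (hk1 : k < 1)
    (hs : ∀ n : ℕ, jacobiSn k (w * ((n : ℝ) + 1)) ≠ 0) (n m : ℕ) :
    ∑ i ∈ Finset.range (n + 1), ∑ j ∈ Finset.range (m + 1),
      cnCoeff k w n i * cnCoeff k w m j * jacobiCn k (w * ((i : ℝ) - j)) =
    if n = m then cnNorm k w n else 0 := by
  -- For `m ≤ n` the inner sum is the transform at `-wj`, which vanishes for `j < n`; at most `j = m
  -- = n` survives. The other case follows since `cn` is even.
  have key : ∀ n m : ℕ, m ≤ n → ∑ j ∈ Finset.range (m + 1), ∑ i ∈ Finset.range (n + 1),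
      cnCoeff k w m j * cnCoeff k w n i * jacobiCn k (w * ((j : ℝ) - i)) =
      if n = m then cnNorm k w n else 0 := fun n m hmn => by
    have h : ∀ j : ℕ, ∑ i ∈ Finset.range (n + 1),
        cnCoeff k w m j * cnCoeff k w n i * jacobiCn k (w * ((j : ℝ) - i)) =
        cnCoeff k w m j * cnTransform k w n (-(w * j)) := fun j => by
      rw [cnTransform, Finset.mul_sum]
      refine Finset.sum_congr rfl fun i _ => ?_
      rw [mul_assoc, ← jacobiCn_neg hk0 hk1]
      congr 3
      ring
    rw [Finset.sum_congr rfl fun j _ => h j, Finset.sum_range_succ, Finset.sum_eq_zero fun j hj => by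
      rw [cnTransform_neg_of_lt hk0 hk1 hs ((Finset.mem_range.1 hj).trans_le hmn), mul_zero],
      zero_add, cnCoeff_self hk0 hk1 hs, one_mul]
    split_ifs with h'
    · rw [← h', cnTransform_neg_self hk0 hk1 hs]
    · exact cnTransform_neg_of_lt hk0 hk1 hs (by omega)
  rcases le_total n m with h | h
  · rw [key m n h]
    simp only [eq_comm (a := m)]
    split_ifs with h'
    · rw [h']
    · rfl
  · rw [← key n m h, Finset.sum_comm]
    refine Finset.sum_congr rfl fun j _ => Finset.sum_congr rfl fun i _ => ?_
    rw [mul_comm (cnCoeff k w n i), ← jacobiCn_neg hk0 hk1]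
    congr 2
    ring

end CnPolynomials

/-! ### Fourier coefficients of `cn` by a real-variable contour shift. -/

section FourierCoefficients

open Set Filter Topology MeasureTheory

attribute [fun_prop] continuous_jacobiSn continuous_jacobiCn continuous_jacobiDn

/-- Differentiation under the integral sign: a compact neighbourhood of `v₀` times the interval
gives a constant dominating bound. -/
theorem hasDerivAt_intervalIntegral_of_continuousOn {f f' : ℝ → ℝ → ℝ} (a b : ℝ) {r v₀ : ℝ}
    (hv₀ : v₀ ∈ Ioo (-r) r) (hf : ∀ v ∈ Ioo (-r) r, Continuous (f v))
    (hf' : ContinuousOn (Function.uncurry f') (Ioo (-r) r ×ˢ univ))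
    (hd : ∀ v ∈ Ioo (-r) r, ∀ u, HasDerivAt (fun v => f v u) (f' v u) v) :
    HasDerivAt (fun v => ∫ u in a..b, f v u) (∫ u in a..b, f' v₀ u) v₀ := by
  obtain ⟨ε, hε, hball⟩ := Metric.nhds_basis_closedBall.mem_iff.1 (isOpen_Ioo.mem_nhds hv₀)
  obtain ⟨M, hM⟩ := ((isCompact_closedBall v₀ ε).prod
    (isCompact_uIcc (a := a) (b := b))).exists_bound_of_continuousOn (hf'.mono (prod_mono hball (subset_univ _)))
  have hc : Continuous (f' v₀) := by
    rw [← continuousOn_univ]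
    exact hf'.comp (f := fun u => (v₀, u)) (by fun_prop) fun u _ => ⟨hv₀, trivial⟩
  refine (intervalIntegral.hasDerivAt_integral_of_dominated_loc_of_deriv_le (F' := f')
    (bound := fun _ => M) (s := Metric.closedBall v₀ ε) (Metric.closedBall_mem_nhds v₀ hε)
    ?_ ((hf v₀ hv₀).intervalIntegrable _ _) hc.aestronglyMeasurable ?_
    intervalIntegrable_const ?_).2
  · filter_upwards [isOpen_Ioo.mem_nhds hv₀] with v hv using (hf v hv).aestronglyMeasurable
  · exact Eventually.of_forall fun u hu v hv => hM (v, u) ⟨hv, uIoc_subset_uIcc hu⟩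
  · exact Eventually.of_forall fun u _ v hv => hd v (hball hv) u

variable {k l : ℝ}

/-- The denominator of `cn(u + iv)`, with `l` the complementary modulus. -/
noncomputable def cnImagDenom (k l u v : ℝ) : ℝ :=
  jacobiCn l v ^ 2 + k ^ 2 * jacobiSn k u ^ 2 * jacobiSn l v ^ 2

/-- The real part of `cn(u + iv)`. -/
noncomputable def cnRe (k l u v : ℝ) : ℝ := jacobiCn k u * jacobiCn l v / cnImagDenom k l u v

/-- The imaginary part of `cn(u + iv)`. -/
noncomputable def cnIm (k l u v : ℝ) : ℝ :=
  -(jacobiSn k u * jacobiDn k u * (jacobiSn l v * jacobiDn l v)) / cnImagDenom k l u v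

/-- The partial derivative of the real part of `cn(u + iv)` in the direction of `u`. -/
noncomputable def cnReDeriv (k l u v : ℝ) : ℝ :=
  -(jacobiSn k u * jacobiDn k u * jacobiCn l v *
    (cnImagDenom k l u v + 2 * k ^ 2 * jacobiCn k u ^ 2 * jacobiSn l v ^ 2)) /
      cnImagDenom k l u v ^ 2

/-- The partial derivative of the imaginary part of `cn(u + iv)` in the direction of `u`. -/
noncomputable def cnImDeriv (k l u v : ℝ) : ℝ :=
  jacobiCn k u * (jacobiSn l v * jacobiDn l v) *
    (cnImagDenom k l u v - 2 * jacobiCn l v ^ 2 + 2 * k ^ 2 * jacobiSn k u ^ 2 * jacobiCn l v ^ 2) /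
      cnImagDenom k l u v ^ 2

/-- The poles of `cn(u+iv)` need `cn(v, l) = 0`, which is excluded for `|v| < K(l)`. -/
theorem cnImagDenom_pos (hl0 : 0 < l) (hl1 : l < 1) (u : ℝ) {v : ℝ}
    (hv : v ∈ Ioo (-ellipticK l) (ellipticK l)) : 0 < cnImagDenom k l u v := by
  have := jacobiCn_pos hl0 hl1 hv.1 hv.2
  unfold cnImagDenom
  positivity

theorem hasDerivAt_cnRe_left (hk0 : 0 < k) (hk1 : k < 1) {u v : ℝ}
    (hD : cnImagDenom k l u v ≠ 0) :
    HasDerivAt (fun u => cnRe k l u v) (cnReDeriv k l u v) u := by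
  have s1 := hasDerivAt_jacobiSn hk0 hk1 u
  have c1 := hasDerivAt_jacobiCn hk0 hk1 u
  refine ((c1.mul_const (jacobiCn l v)).div ((((s1.pow 2).const_mul (k ^ 2)).mul_const
    (jacobiSn l v ^ 2)).const_add (jacobiCn l v ^ 2)) hD).congr_deriv ?_
  change _ / cnImagDenom k l u v ^ 2 = _
  rw [cnReDeriv]
  congr 1
  simp only [Pi.pow_apply, cnImagDenom]
  norm_num
  ring

theorem hasDerivAt_cnIm_left (hk0 : 0 < k) (hk1 : k < 1) {u v : ℝ}
    (hD : cnImagDenom k l u v ≠ 0) :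
    HasDerivAt (fun u => cnIm k l u v) (cnImDeriv k l u v) u := by
  have s1 := hasDerivAt_jacobiSn hk0 hk1 u
  have d1 := hasDerivAt_jacobiDn hk0 hk1 u
  refine ((((s1.mul d1).mul_const (jacobiSn l v * jacobiDn l v)).neg).div
    ((((s1.pow 2).const_mul (k ^ 2)).mul_const
    (jacobiSn l v ^ 2)).const_add (jacobiCn l v ^ 2)) hD).congr_deriv ?_
  change _ / cnImagDenom k l u v ^ 2 = _
  rw [cnImDeriv]
  congr 1
  have e2 := jacobiDn_sq hk0 hk1 u
  simp only [Pi.pow_apply, Pi.mul_apply, Pi.neg_apply, cnImagDenom]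
  norm_num
  grind

/-- Together with `hasDerivAt_cnIm_left`, one Cauchy–Riemann equation. -/
theorem hasDerivAt_cnRe_right (hl0 : 0 < l) (hl1 : l < 1)
    {u v : ℝ} (hD : cnImagDenom k l u v ≠ 0) :
    HasDerivAt (fun v => cnRe k l u v) (-cnImDeriv k l u v) v := by
  have s1 := hasDerivAt_jacobiSn hl0 hl1 v
  have c1 := hasDerivAt_jacobiCn hl0 hl1 v
  refine ((c1.const_mul (jacobiCn k u)).div ((c1.pow 2).add ((s1.pow 2).const_mul
    (k ^ 2 * jacobiSn k u ^ 2))) hD).congr_deriv ?_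
  change _ / cnImagDenom k l u v ^ 2 = _
  rw [cnImDeriv, ← neg_div]
  congr 1
  simp only [Pi.pow_apply, Pi.add_apply, cnImagDenom]
  norm_num
  ring

/-- The other Cauchy–Riemann equation, and the place where the moduli must be complementary. -/
theorem hasDerivAt_cnIm_right (hk0 : 0 < k) (hk1 : k < 1) (hl0 : 0 < l) (hl1 : l < 1)
    (hkl : k ^ 2 + l ^ 2 = 1) {u v : ℝ} (hD : cnImagDenom k l u v ≠ 0) :
    HasDerivAt (fun v => cnIm k l u v) (cnReDeriv k l u v) v := by
  have s1 := hasDerivAt_jacobiSn hl0 hl1 v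
  have c1 := hasDerivAt_jacobiCn hl0 hl1 v
  have d1 := hasDerivAt_jacobiDn hl0 hl1 v
  refine ((((s1.mul d1).const_mul (jacobiSn k u * jacobiDn k u)).neg).div
    ((c1.pow 2).add ((s1.pow 2).const_mul (k ^ 2 * jacobiSn k u ^ 2))) hD).congr_deriv ?_
  change _ / cnImagDenom k l u v ^ 2 = _
  rw [cnReDeriv]
  congr 1
  have e1 := jacobiDn_sq hk0 hk1 u
  have e2 := jacobiDn_sq hl0 hl1 v
  have e3 := jacobiCn_sq (k := k) u
  have e4 := jacobiCn_sq (k := l) v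
  simp only [Pi.pow_apply, Pi.mul_apply, Pi.neg_apply, Pi.add_apply, cnImagDenom]
  norm_num
  grind

theorem continuous_cnImagDenom (hk0 : 0 < k) (hk1 : k < 1) (hl0 : 0 < l) (hl1 : l < 1) :
    Continuous fun p : ℝ × ℝ => cnImagDenom k l p.2 p.1 := by
  unfold cnImagDenom
  fun_prop (disch := assumption)

theorem continuousOn_cnReDeriv (hk0 : 0 < k) (hk1 : k < 1) (hl0 : 0 < l) (hl1 : l < 1) :
    ContinuousOn (fun p : ℝ × ℝ => cnReDeriv k l p.2 p.1)
      (Ioo (-ellipticK l) (ellipticK l) ×ˢ univ) := by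
  have h := continuous_cnImagDenom hk0 hk1 hl0 hl1
  unfold cnReDeriv
  refine ContinuousOn.div (Continuous.continuousOn ?_) (Continuous.continuousOn (by fun_prop))
    fun p hp => (pow_pos (cnImagDenom_pos hl0 hl1 p.2 hp.1) 2).ne'
  fun_prop (disch := assumption)

theorem continuousOn_cnImDeriv (hk0 : 0 < k) (hk1 : k < 1) (hl0 : 0 < l) (hl1 : l < 1) :
    ContinuousOn (fun p : ℝ × ℝ => cnImDeriv k l p.2 p.1)
      (Ioo (-ellipticK l) (ellipticK l) ×ˢ univ) := by
  have h := continuous_cnImagDenom hk0 hk1 hl0 hl1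
  unfold cnImDeriv
  refine ContinuousOn.div (Continuous.continuousOn ?_) (Continuous.continuousOn (by fun_prop))
    fun p hp => (pow_pos (cnImagDenom_pos hl0 hl1 p.2 hp.1) 2).ne'
  fun_prop (disch := assumption)

theorem continuous_cnRe_left (hk0 : 0 < k) (hk1 : k < 1) (hl0 : 0 < l) (hl1 : l < 1) {v : ℝ}
    (hv : v ∈ Ioo (-ellipticK l) (ellipticK l)) : Continuous fun u => cnRe k l u v :=
  continuous_iff_continuousAt.2 fun u =>
    (hasDerivAt_cnRe_left hk0 hk1 (cnImagDenom_pos hl0 hl1 u hv).ne').continuousAt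

theorem continuous_cnIm_left (hk0 : 0 < k) (hk1 : k < 1) (hl0 : 0 < l) (hl1 : l < 1) {v : ℝ}
    (hv : v ∈ Ioo (-ellipticK l) (ellipticK l)) : Continuous fun u => cnIm k l u v :=
  continuous_iff_continuousAt.2 fun u =>
    (hasDerivAt_cnIm_left hk0 hk1 (cnImagDenom_pos hl0 hl1 u hv).ne').continuousAt

theorem continuous_slice {f : ℝ → ℝ → ℝ} {s : Set ℝ}
    (h : ContinuousOn (fun p : ℝ × ℝ => f p.2 p.1) (s ×ˢ univ)) {v : ℝ} (hv : v ∈ s) :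
    Continuous fun u => f u v := by
  rw [← continuousOn_univ]
  exact h.comp (f := fun u => (v, u)) (by fun_prop) fun u _ => ⟨hv, trivial⟩

theorem jacobiSn_two_mul_ellipticK (hk0 : 0 < k) (hk1 : k < 1) :
    jacobiSn k (2 * ellipticK k) = 0 := by
  have h := jacobiSn_add_two_ellipticK hk0 hk1 0
  rwa [zero_add, jacobiSn_zero hk0 hk1, neg_zero] at h

/-- Cauchy–Riemann turns the `v`-derivative into a `u`-derivative, which is integrated by parts. The
boundary terms vanish because `sn` is zero at `0` and `2K`; in the companion lemma, because
`sin(2Kα) = 0`. -/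
theorem hasDerivAt_integral_cnRe_mul_cos (hk0 : 0 < k) (hk1 : k < 1) (hl0 : 0 < l) (hl1 : l < 1)
    (α : ℝ) {v : ℝ} (hv : v ∈ Ioo (-ellipticK l) (ellipticK l)) :
    HasDerivAt (fun v => ∫ u in 0..2 * ellipticK k, cnRe k l u v * Real.cos (α * u))
      (-α * ∫ u in 0..2 * ellipticK k, cnIm k l u v * Real.sin (α * u)) v := by
  have h1 := hasDerivAt_intervalIntegral_of_continuousOn
    (f := fun v u => cnRe k l u v * Real.cos (α * u))
    (f' := fun v u => -cnImDeriv k l u v * Real.cos (α * u)) 0 (2 * ellipticK k) hv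
    (fun v hv => (continuous_cnRe_left hk0 hk1 hl0 hl1 hv).mul (by fun_prop))
    ((continuousOn_cnImDeriv hk0 hk1 hl0 hl1).neg.mul (Continuous.continuousOn (by fun_prop)))
    (fun v hv u => (hasDerivAt_cnRe_right hl0 hl1
      (cnImagDenom_pos hl0 hl1 u hv).ne').mul_const _)
  refine h1.congr_deriv ?_
  have h2 := intervalIntegral.integral_mul_deriv_eq_deriv_mul (a := 0) (b := 2 * ellipticK k)
    (u := fun u => Real.cos (α * u)) (u' := fun u => -Real.sin (α * u) * α)
    (v := fun u => cnIm k l u v) (v' := fun u => cnImDeriv k l u v)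
    (fun u _ => by simpa using ((hasDerivAt_id u).const_mul α).cos)
    (fun u _ => hasDerivAt_cnIm_left hk0 hk1 (cnImagDenom_pos hl0 hl1 u hv).ne')
    (Continuous.intervalIntegrable (by fun_prop) _ _)
    ((continuous_slice (continuousOn_cnImDeriv hk0 hk1 hl0 hl1) hv).intervalIntegrable _ _)
  have e1 : cnIm k l (2 * ellipticK k) v = 0 := by
    simp [cnIm, jacobiSn_two_mul_ellipticK hk0 hk1]
  have e2 : cnIm k l 0 v = 0 := by simp [cnIm, jacobiSn_zero hk0 hk1]
  rw [e1, e2, mul_zero, mul_zero, sub_zero, zero_sub] at h2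
  rw [← intervalIntegral.integral_const_mul]
  calc _ = -∫ u in 0..2 * ellipticK k, Real.cos (α * u) * cnImDeriv k l u v := by
        rw [← intervalIntegral.integral_neg]
        congr 1 with u; ring
    _ = _ := by
        rw [h2, neg_neg]
        congr 1 with u; ring

theorem hasDerivAt_integral_cnIm_mul_sin (hk0 : 0 < k) (hk1 : k < 1) (hl0 : 0 < l) (hl1 : l < 1)
    (hkl : k ^ 2 + l ^ 2 = 1) {α : ℝ} (hα : Real.sin (α * (2 * ellipticK k)) = 0) {v : ℝ}
    (hv : v ∈ Ioo (-ellipticK l) (ellipticK l)) :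
    HasDerivAt (fun v => ∫ u in 0..2 * ellipticK k, cnIm k l u v * Real.sin (α * u))
      (-α * ∫ u in 0..2 * ellipticK k, cnRe k l u v * Real.cos (α * u)) v := by
  have h1 := hasDerivAt_intervalIntegral_of_continuousOn
    (f := fun v u => cnIm k l u v * Real.sin (α * u))
    (f' := fun v u => cnReDeriv k l u v * Real.sin (α * u)) 0 (2 * ellipticK k) hv
    (fun v hv => (continuous_cnIm_left hk0 hk1 hl0 hl1 hv).mul (by fun_prop))
    ((continuousOn_cnReDeriv hk0 hk1 hl0 hl1).mul (Continuous.continuousOn (by fun_prop)))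
    (fun v hv u => (hasDerivAt_cnIm_right hk0 hk1 hl0 hl1 hkl
      (cnImagDenom_pos hl0 hl1 u hv).ne').mul_const _)
  refine h1.congr_deriv ?_
  have h2 := intervalIntegral.integral_mul_deriv_eq_deriv_mul (a := 0) (b := 2 * ellipticK k)
    (u := fun u => Real.sin (α * u)) (u' := fun u => Real.cos (α * u) * α)
    (v := fun u => cnRe k l u v) (v' := fun u => cnReDeriv k l u v)
    (fun u _ => by simpa using ((hasDerivAt_id u).const_mul α).sin)
    (fun u _ => hasDerivAt_cnRe_left hk0 hk1 (cnImagDenom_pos hl0 hl1 u hv).ne')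
    (Continuous.intervalIntegrable (by fun_prop) _ _)
    ((continuous_slice (continuousOn_cnReDeriv hk0 hk1 hl0 hl1) hv).intervalIntegrable _ _)
  rw [hα, mul_zero, Real.sin_zero, zero_mul, zero_mul, sub_zero, zero_sub] at h2
  rw [← intervalIntegral.integral_const_mul]
  calc _ = ∫ u in 0..2 * ellipticK k, Real.sin (α * u) * cnReDeriv k l u v := by
        congr 1 with u; ring
    _ = _ := by
        rw [h2, ← intervalIntegral.integral_neg]
        congr 1 with u; ring

theorem cnRe_zero_right (hl0 : 0 < l) (hl1 : l < 1) (u : ℝ) : cnRe k l u 0 = jacobiCn k u := by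
  simp [cnRe, cnImagDenom, jacobiSn_zero hl0 hl1, jacobiCn_zero hl0 hl1]

theorem integral_cnRe_mul_cos (hk0 : 0 < k) (hk1 : k < 1) (hl0 : 0 < l) (hl1 : l < 1)
    (hkl : k ^ 2 + l ^ 2 = 1) {α : ℝ} (hα : Real.sin (α * (2 * ellipticK k)) = 0) {v : ℝ}
    (hv : v ∈ Ioo (-ellipticK l) (ellipticK l)) :
    ∫ u in 0..2 * ellipticK k, cnRe k l u v * Real.cos (α * u) =
      (∫ u in 0..2 * ellipticK k, jacobiCn k u * Real.cos (α * u)) * Real.cosh (α * v) := by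
  set A : ℝ → ℝ := fun v => ∫ u in 0..2 * ellipticK k, cnRe k l u v * Real.cos (α * u) with hA
  set B : ℝ → ℝ := fun v => ∫ u in 0..2 * ellipticK k, cnIm k l u v * Real.sin (α * u) with hB
  have dA : ∀ v ∈ Ioo (-ellipticK l) (ellipticK l), HasDerivAt A (-α * B v) v := fun v hv =>
    hasDerivAt_integral_cnRe_mul_cos hk0 hk1 hl0 hl1 α hv
  have dB : ∀ v ∈ Ioo (-ellipticK l) (ellipticK l), HasDerivAt B (-α * A v) v := fun v hv =>
    hasDerivAt_integral_cnIm_mul_sin hk0 hk1 hl0 hl1 hkl hα hv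
  have dc : ∀ v : ℝ, HasDerivAt (fun v => Real.cosh (α * v)) (Real.sinh (α * v) * α) v := fun v => by
    simpa using ((hasDerivAt_id v).const_mul α).cosh
  have ds : ∀ v : ℝ, HasDerivAt (fun v => Real.sinh (α * v)) (Real.cosh (α * v) * α) v := fun v => by
    simpa using ((hasDerivAt_id v).const_mul α).sinh
  have h0 : (0 : ℝ) ∈ Ioo (-ellipticK l) (ellipticK l) := by
    have := ellipticK_pos hl0 hl1
    constructor <;> linarith
  have d1 : ∀ v ∈ Ioo (-ellipticK l) (ellipticK l),
      HasDerivAt (fun v => A v * Real.cosh (α * v) + B v * Real.sinh (α * v)) 0 v := fun v hv =>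
    (((dA v hv).mul (dc v)).add ((dB v hv).mul (ds v))).congr_deriv (by ring)
  have d2 : ∀ v ∈ Ioo (-ellipticK l) (ellipticK l),
      HasDerivAt (fun v => A v * Real.sinh (α * v) + B v * Real.cosh (α * v)) 0 v := fun v hv =>
    (((dA v hv).mul (ds v)).add ((dB v hv).mul (dc v))).congr_deriv (by ring)
  have c1 := isOpen_Ioo.is_const_of_deriv_eq_zero isPreconnected_Ioo
    (fun v hv => (d1 v hv).differentiableAt.differentiableWithinAt) (fun v hv => (d1 v hv).deriv)
    hv h0
  have c2 := isOpen_Ioo.is_const_of_deriv_eq_zero isPreconnected_Ioo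
    (fun v hv => (d2 v hv).differentiableAt.differentiableWithinAt) (fun v hv => (d2 v hv).deriv)
    hv h0
  have hA0 : A 0 = ∫ u in 0..2 * ellipticK k, jacobiCn k u * Real.cos (α * u) := by
    simp only [hA, cnRe_zero_right hl0 hl1]
  have hB0 : B 0 = 0 := by
    simp [hB, cnIm, jacobiSn_zero hl0 hl1]
  simp only [mul_zero, Real.cosh_zero, Real.sinh_zero, mul_one, add_zero, hB0] at c1 c2
  rw [← hA0]
  -- The system `A' = -αB`, `B' = -αA` conserves `A cosh + B sinh = A 0` and `A sinh + B cosh = 0`;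
  -- eliminate `B`.
  linear_combination Real.cosh (α * v) * c1 - Real.sinh (α * v) * c2
    - A v * Real.cosh_sq_sub_sinh_sq (α * v)

/-- As `v → K(l)` the mass concentrates at the endpoints, where the poles are. Integration by parts
replaces the unbounded integrand by a bounded arctangent, to which dominated convergence applies. -/
theorem tendsto_integral_cnRe_mul_cos (hk0 : 0 < k) (hk1 : k < 1) (hl0 : 0 < l) (hl1 : l < 1)
    {α : ℝ} (hα : Real.cos (α * (2 * ellipticK k)) = -1) :
    Tendsto (fun v => ∫ u in 0..2 * ellipticK k, cnRe k l u v * Real.cos (α * u))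
      (𝓝[<] ellipticK l) (𝓝 (Real.pi / k)) := by
  have hK := ellipticK_pos hk0 hk1
  have hL := ellipticK_pos hl0 hl1
  have hdpos := jacobiDn_pos hk0 hk1
  -- `T v` is a primitive of `cnRe · dn`. It vanishes at both endpoints, yet tends to `π/(2k)` at
  -- every interior point.
  set T : ℝ → ℝ → ℝ := fun v u =>
    Real.arctan (k * jacobiSn l v * jacobiSn k u / jacobiCn l v) / (k * jacobiSn l v) with hT
  set ψ : ℝ → ℝ := fun u => Real.cos (α * u) / jacobiDn k u with hψ
  set ψ' : ℝ → ℝ := fun u => (-Real.sin (α * u) * α * jacobiDn k u -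
    Real.cos (α * u) * (-k ^ 2 * jacobiSn k u * jacobiCn k u)) / jacobiDn k u ^ 2 with hψ'
  have dψ : ∀ u, HasDerivAt ψ (ψ' u) u := fun u => by
    have h : HasDerivAt (fun u => Real.cos (α * u)) (-Real.sin (α * u) * α) u := by
      simpa using ((hasDerivAt_id u).const_mul α).cos
    exact h.div (hasDerivAt_jacobiDn hk0 hk1 u) (hdpos u).ne'
  have cψ' : Continuous ψ' := by
    refine Continuous.div ?_ ?_ fun u => (pow_pos (hdpos u) 2).ne'
    · fun_prop (disch := assumption)
    · fun_prop (disch := assumption)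
  have hmem : ∀ᶠ v in 𝓝[<] ellipticK l, v ∈ Ioo 0 (ellipticK l) := Ioo_mem_nhdsLT hL
  have hs : Tendsto (jacobiSn l) (𝓝[<] ellipticK l) (𝓝 1) := by
    have h := (continuous_jacobiSn hl0 hl1).tendsto (ellipticK l)
    rw [jacobiSn_ellipticK hl0 hl1] at h
    exact h.mono_left nhdsWithin_le_nhds
  have hc : Tendsto (jacobiCn l) (𝓝[<] ellipticK l) (𝓝[>] 0) := by
    refine tendsto_nhdsWithin_iff.2 ⟨?_, ?_⟩
    · have h := (continuous_jacobiCn hl0 hl1).tendsto (ellipticK l)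
      rw [jacobiCn_ellipticK hl0 hl1] at h
      exact h.mono_left nhdsWithin_le_nhds
    · filter_upwards [hmem] with v hv using jacobiCn_pos hl0 hl1 (by linarith [hv.1]) hv.2
  have parts : ∀ᶠ v in 𝓝[<] ellipticK l,
      ∫ u in 0..2 * ellipticK k, -(ψ' u * T v u) =
        ∫ u in 0..2 * ellipticK k, cnRe k l u v * Real.cos (α * u) := by
    filter_upwards [hmem] with v hv
    have hv' : v ∈ Ioo (-ellipticK l) (ellipticK l) := ⟨by linarith [hv.1], hv.2⟩
    have s0 : 0 < jacobiSn l v := jacobiSn_pos hl0 hl1 hv.1 (by linarith [hv.2])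
    have c0 : 0 < jacobiCn l v := jacobiCn_pos hl0 hl1 hv'.1 hv'.2
    have dT : ∀ u, HasDerivAt (T v) (cnRe k l u v * jacobiDn k u) u := fun u => by
      refine ((((hasDerivAt_jacobiSn hk0 hk1 u).const_mul (k * jacobiSn l v)).div_const
        (jacobiCn l v)).arctan.div_const (k * jacobiSn l v)).congr_deriv ?_
      have hD := cnImagDenom_pos (k := k) hl0 hl1 u hv'
      rw [cnRe]
      have e : 1 + (k * jacobiSn l v * jacobiSn k u / jacobiCn l v) ^ 2 =
          cnImagDenom k l u v / jacobiCn l v ^ 2 := by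
        unfold cnImagDenom
        field_simp
      rw [e]
      field_simp
    have h := intervalIntegral.integral_mul_deriv_eq_deriv_mul (a := 0) (b := 2 * ellipticK k)
      (fun u _ => dψ u) (fun u _ => dT u) (cψ'.intervalIntegrable _ _)
      (((continuous_cnRe_left hk0 hk1 hl0 hl1 hv').mul
        (continuous_jacobiDn hk0 hk1)).intervalIntegrable _ _)
    have e1 : T v (2 * ellipticK k) = 0 := by
      simp [hT, jacobiSn_two_mul_ellipticK hk0 hk1]
    have e2 : T v 0 = 0 := by simp [hT, jacobiSn_zero hk0 hk1]
    rw [e1, e2, mul_zero, mul_zero, sub_zero, zero_sub, ← intervalIntegral.integral_neg] at h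
    rw [← h]
    congr 1 with u
    have := (hdpos u).ne'
    simp only [hψ]
    field_simp
  -- The limit is `-(π/(2k))(ψ(2K) - ψ(0))`, with `ψ(2K) = -1` and `ψ(0) = 1`.
  have hval : ∫ u in 0..2 * ellipticK k, -(ψ' u * (Real.pi / 2 / k)) = Real.pi / k := by
    rw [intervalIntegral.integral_neg, intervalIntegral.integral_mul_const,
      intervalIntegral.integral_eq_sub_of_hasDerivAt (fun u _ => dψ u)
        (cψ'.intervalIntegrable _ _)]
    have hd2 := jacobiDn_add_two_ellipticK hk0 hk1 0
    rw [zero_add, jacobiDn_zero hk0 hk1] at hd2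
    simp only [hψ, hα, hd2, mul_zero, Real.cos_zero, jacobiDn_zero hk0 hk1]
    field_simp
    norm_num
  rw [← hval]
  refine Tendsto.congr' parts (intervalIntegral.tendsto_integral_filter_of_dominated_convergence
    (fun u => |ψ' u| * (Real.pi / k)) ?_ ?_ ?_ ?_)
  · refine Eventually.of_forall fun v => Measurable.aestronglyMeasurable ?_
    have h1 := (continuous_jacobiSn hk0 hk1).measurable
    have h2 := cψ'.measurable
    simp only [hT]
    exact (h2.mul ((Real.measurable_arctan.comp ((h1.const_mul _).div_const _)).div_const _)).neg
  -- Once `sn(v, l) > 1/2`, the bound `|arctan| ≤ π/2` gives `|T v u| ≤ π/k`.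
  · filter_upwards [hs.eventually (lt_mem_nhds (show (1 / 2 : ℝ) < 1 by norm_num))] with v hv
    refine Eventually.of_forall fun u _ => ?_
    rw [Real.norm_eq_abs, abs_neg, abs_mul]
    refine mul_le_mul_of_nonneg_left ?_ (abs_nonneg _)
    have hp : 0 < k * jacobiSn l v := by positivity
    simp only [hT]
    rw [abs_div, abs_of_pos hp, div_le_div_iff₀ hp hk0]
    have h1 : |Real.arctan (k * jacobiSn l v * jacobiSn k u / jacobiCn l v)| ≤ Real.pi / 2 :=
      abs_le.2 ⟨(Real.neg_pi_div_two_lt_arctan _).le, (Real.arctan_lt_pi_div_two _).le⟩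
    have h2 : Real.pi / 2 * k ≤ Real.pi * (k * jacobiSn l v) := by
      have := mul_pos Real.pi_pos hk0
      nlinarith
    exact (mul_le_mul_of_nonneg_right h1 hk0.le).trans h2
  · exact (cψ'.abs.mul continuous_const).intervalIntegrable _ _
  -- The endpoint `2K`, where `T` stays zero, is a null set; inside, `sn u > 0` sends the argument
  -- of the arctangent to `+∞`.
  · filter_upwards [Measure.ae_ne volume (2 * ellipticK k)] with u hne hu
    rw [uIoc_of_le (by positivity)] at hu
    have hu2 : u < 2 * ellipticK k := lt_of_le_of_ne hu.2 hne
    have sp := jacobiSn_pos hk0 hk1 hu.1 hu2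
    have h1 : Tendsto (fun v => k * jacobiSn l v * jacobiSn k u / jacobiCn l v)
        (𝓝[<] ellipticK l) atTop := by
      have ha : Tendsto (fun v => k * jacobiSn l v * jacobiSn k u) (𝓝[<] ellipticK l)
          (𝓝 (k * 1 * jacobiSn k u)) := (hs.const_mul k).mul_const _
      exact ha.pos_mul_atTop (by positivity) (tendsto_inv_nhdsGT_zero.comp hc)
    have h2 := (Real.tendsto_arctan_atTop.mono_right nhdsWithin_le_nhds).comp h1
    have h3 := h2.div (hs.const_mul k) (by simpa using hk0.ne')
    rw [mul_one] at h3
    exact (h3.const_mul (ψ' u)).neg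

/-- The Fourier coefficients of `cn`. -/
theorem integral_jacobiCn_mul_cos (hk0 : 0 < k) (hk1 : k < 1) (hl0 : 0 < l) (hl1 : l < 1)
    (hkl : k ^ 2 + l ^ 2 = 1) {α : ℝ} (hα : Real.cos (α * (2 * ellipticK k)) = -1) :
    ∫ u in 0..2 * ellipticK k, jacobiCn k u * Real.cos (α * u) =
      Real.pi / (k * Real.cosh (α * ellipticK l)) := by
  have hα' : Real.sin (α * (2 * ellipticK k)) = 0 := by
    have := Real.sin_sq_add_cos_sq (α * (2 * ellipticK k))
    rw [hα] at this
    nlinarith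
  have hL := ellipticK_pos hl0 hl1
  -- The height `K(l)` itself is only reached as a limit: the `cosh` formula and the pole
  -- computation are compared there.
  have h1 : Tendsto (fun v =>
      (∫ u in 0..2 * ellipticK k, jacobiCn k u * Real.cos (α * u)) * Real.cosh (α * v))
      (𝓝[<] ellipticK l) (𝓝 ((∫ u in 0..2 * ellipticK k, jacobiCn k u * Real.cos (α * u)) *
        Real.cosh (α * ellipticK l))) :=
    (Continuous.tendsto (by fun_prop) _).mono_left nhdsWithin_le_nhds
  have h2 := tendsto_integral_cnRe_mul_cos hk0 hk1 hl0 hl1 hα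
  have h3 := tendsto_nhds_unique (h1.congr' ?_) h2
  · have hc := Real.cosh_pos (α * ellipticK l)
    rw [eq_div_iff (by positivity)]
    field_simp at h3
    linarith
  · filter_upwards [Ioo_mem_nhdsLT hL] with v hv
    exact (integral_cnRe_mul_cos hk0 hk1 hl0 hl1 hkl hα' ⟨by linarith [hv.1], hv.2⟩).symm

end FourierCoefficients

/-! ### Weights, Fourier series of `cn`, orthogonality on the points `z_s`. -/

section Orthogonality

variable {k w : ℝ}

theorem sqrt_one_sub_sq_mem (hk0 : 0 < k) (hk1 : k < 1) :
    0 < Real.sqrt (1 - k ^ 2) ∧ Real.sqrt (1 - k ^ 2) < 1 ∧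
      k ^ 2 + Real.sqrt (1 - k ^ 2) ^ 2 = 1 := by
  have h : 0 < 1 - k ^ 2 := by nlinarith
  refine ⟨Real.sqrt_pos.2 h, ?_, ?_⟩
  · rw [Real.sqrt_lt' one_pos]
    nlinarith
  · rw [Real.sq_sqrt h.le]
    ring

/-- The frequencies `π (s - 1/2) / K` of `cn`. -/
noncomputable def cnFrequency (k : ℝ) (s : ℤ) : ℝ := Real.pi * ((s : ℝ) - 1 / 2) / ellipticK k

theorem ellipticNome_rpow (x : ℝ) : ellipticNome k ^ x =
    Real.exp (-(Real.pi * x / ellipticK k * ellipticK (Real.sqrt (1 - k ^ 2)))) := by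
  rw [ellipticNome, ← Real.exp_mul]
  congr 1
  ring

theorem cnWeight_eq_exp (s : ℤ) : cnWeight k s = Real.pi / (k * ellipticK k) *
    (1 / (Real.exp (-(cnFrequency k s * ellipticK (Real.sqrt (1 - k ^ 2)))) +
      Real.exp (cnFrequency k s * ellipticK (Real.sqrt (1 - k ^ 2))))) := by
  rw [cnWeight, ellipticNome_rpow, ellipticNome_rpow, cnFrequency]
  congr 5
  ring

theorem cnWeight_eq_cosh (s : ℤ) : cnWeight k s = Real.pi / (k * ellipticK k) *
    (1 / (2 * Real.cosh (cnFrequency k s * ellipticK (Real.sqrt (1 - k ^ 2))))) := by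
  rw [cnWeight_eq_exp, Real.cosh_eq]
  ring

theorem cnWeight_pos (hk0 : 0 < k) (hk1 : k < 1) (s : ℤ) : 0 < cnWeight k s := by
  have := ellipticK_pos hk0 hk1
  rw [cnWeight_eq_exp]
  positivity

theorem summable_cnWeight (hk0 : 0 < k) (hk1 : k < 1) : Summable (cnWeight k) := by
  obtain ⟨hl0, hl1, -⟩ := sqrt_one_sub_sq_mem hk0 hk1
  have hK := ellipticK_pos hk0 hk1
  have hL := ellipticK_pos hl0 hl1
  set L := ellipticK (Real.sqrt (1 - k ^ 2)) with hLdef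
  -- `exp(-c)` is the nome, and the factors `exp(±c/2)` below come from the shift `s - 1/2`.
  set c := Real.pi / ellipticK k * L with hc
  have hcpos : 0 < c := by positivity
  have hsum : Summable fun n : ℕ => Real.exp (n * -c) :=
    Real.summable_exp_nat_mul_iff.2 (by linarith)
  refine summable_int_iff_summable_nat_and_neg.2 ⟨?_, ?_⟩
  · refine Summable.of_nonneg_of_le (fun n => (cnWeight_pos hk0 hk1 _).le) (fun n => ?_)
      (hsum.mul_left (Real.pi / (k * ellipticK k) * Real.exp (c / 2)))
    rw [cnWeight_eq_exp, mul_assoc]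
    refine mul_le_mul_of_nonneg_left ?_ (by positivity)
    calc _ ≤ 1 / Real.exp (cnFrequency k n * L) :=
          one_div_le_one_div_of_le (Real.exp_pos _) (by linarith [Real.exp_pos (-(cnFrequency k n * L))])
      _ = _ := by
          rw [one_div, ← Real.exp_neg, ← Real.exp_add, cnFrequency]
          congr 1
          push_cast
          ring
  · refine Summable.of_nonneg_of_le (fun n => (cnWeight_pos hk0 hk1 _).le) (fun n => ?_)
      (hsum.mul_left (Real.pi / (k * ellipticK k) * Real.exp (-c / 2)))
    rw [cnWeight_eq_exp, mul_assoc]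
    refine mul_le_mul_of_nonneg_left ?_ (by positivity)
    calc _ ≤ 1 / Real.exp (-(cnFrequency k (-n) * L)) :=
          one_div_le_one_div_of_le (Real.exp_pos _) (by linarith [Real.exp_pos (cnFrequency k (-n) * L)])
      _ = _ := by
          rw [one_div, ← Real.exp_neg, ← Real.exp_add, cnFrequency]
          congr 1
          push_cast
          ring

/-- Under `u ↦ 2K - u`, `cn` changes sign and the sine does not. -/
theorem integral_jacobiCn_mul_sin (hk0 : 0 < k) (hk1 : k < 1) (s : ℤ) :
    ∫ u in 0..2 * ellipticK k, jacobiCn k u * Real.sin (cnFrequency k s * u) = 0 := by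
  have hK := ellipticK_pos hk0 hk1
  have h := intervalIntegral.integral_comp_sub_left (a := 0) (b := 2 * ellipticK k)
    (fun u => jacobiCn k u * Real.sin (cnFrequency k s * u)) (2 * ellipticK k)
  rw [sub_self, sub_zero] at h
  have h2 : ∀ u, jacobiCn k (2 * ellipticK k - u) *
      Real.sin (cnFrequency k s * (2 * ellipticK k - u)) =
      -(jacobiCn k u * Real.sin (cnFrequency k s * u)) := fun u => by
    rw [show 2 * ellipticK k - u = -u + 2 * ellipticK k by ring,
      jacobiCn_add_two_ellipticK hk0 hk1, jacobiCn_neg hk0 hk1,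
      show cnFrequency k s * (-u + 2 * ellipticK k) =
        (Real.pi - (cnFrequency k s * u + Real.pi * 2)) + s * (2 * Real.pi) + Real.pi * 0 by
        rw [cnFrequency]; field_simp; ring, mul_zero, add_zero, Real.sin_add_int_mul_two_pi,
      Real.sin_pi_sub, mul_comm Real.pi 2, Real.sin_add_two_pi]
    ring
  rw [intervalIntegral.integral_congr fun u _ => h2 u, intervalIntegral.integral_neg] at h
  linarith

theorem cos_cnFrequency (hk0 : 0 < k) (hk1 : k < 1) (s : ℤ) :
    Real.cos (cnFrequency k s * (2 * ellipticK k)) = -1 := by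
  have hK := ellipticK_pos hk0 hk1
  rw [show cnFrequency k s * (2 * ellipticK k) = s * (2 * Real.pi) - Real.pi by
    rw [cnFrequency]; field_simp, Real.cos_int_mul_two_pi_sub_pi]

open Complex in
/-- The Fourier series of `cn`. -/
theorem hasSum_jacobiCn (hk0 : 0 < k) (hk1 : k < 1) (u : ℝ) :
    HasSum (fun s : ℤ => (cnWeight k s : ℂ) * exp (cnFrequency k s * u * I)) (jacobiCn k u) := by
  obtain ⟨hl0, hl1, hkl⟩ := sqrt_one_sub_sq_mem hk0 hk1
  have hK := ellipticK_pos hk0 hk1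
  have hKc : (ellipticK k : ℂ) ≠ 0 := ofReal_ne_zero.2 hK.ne'
  have : Fact (0 < 2 * ellipticK k) := ⟨by positivity⟩
  -- `cn` changes sign under `2K`. The twist by `exp(iπu/(2K))` makes it `2K`-periodic and moves the
  -- half-integer frequencies to integers.
  set g : ℝ → ℂ := fun u => jacobiCn k u * exp (Real.pi * u / (2 * ellipticK k) * I) with hg
  have gper : Function.Periodic g (2 * ellipticK k) := fun u => by
    simp only [hg]
    rw [jacobiCn_add_two_ellipticK hk0 hk1,
      show (Real.pi * ((u + 2 * ellipticK k : ℝ) : ℂ) / (2 * ellipticK k) * I : ℂ) =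
        Real.pi * u / (2 * ellipticK k) * I + Real.pi * I by push_cast; field_simp,
      exp_add, exp_pi_mul_I]
    push_cast
    ring
  have gcont : Continuous g := by
    have := continuous_jacobiCn hk0 hk1
    simp only [hg]
    fun_prop (disch := assumption)
  let f : C(AddCircle (2 * ellipticK k), ℂ) := ⟨gper.lift, gcont.quotient_lift _⟩
  have hf : ∀ x : ℝ, f (x : AddCircle (2 * ellipticK k)) = g x := fun x => gper.lift_coe x
  have hcoef : ∀ s : ℤ, fourierCoeff f s = cnWeight k s := fun s => by
    rw [fourierCoeff_eq_intervalIntegral _ _ 0, zero_add]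
    have h1 : ∀ x : ℝ, fourier (-s) (x : AddCircle (2 * ellipticK k)) •
        f (x : AddCircle (2 * ellipticK k)) =
        ((jacobiCn k x * Real.cos (cnFrequency k s * x) : ℝ) : ℂ) -
        ((jacobiCn k x * Real.sin (cnFrequency k s * x) : ℝ) : ℂ) * I := fun x => by
      rw [hf, fourier_coe_apply, smul_eq_mul]
      simp only [hg]
      rw [mul_left_comm, ← exp_add,
        show (2 * Real.pi * I * ((-s : ℤ) : ℂ) * x / ((2 * ellipticK k : ℝ) : ℂ) +
          Real.pi * x / (2 * ellipticK k) * I : ℂ) = ((-(cnFrequency k s * x) : ℝ) : ℂ) * I by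
          rw [cnFrequency]; push_cast; field_simp; ring, exp_mul_I, ← ofReal_cos, ← ofReal_sin,
        Real.cos_neg, Real.sin_neg]
      push_cast
      ring
    have c1 : Continuous fun x => jacobiCn k x * Real.cos (cnFrequency k s * x) := by
      fun_prop (disch := assumption)
    have c2 : Continuous fun x => jacobiCn k x * Real.sin (cnFrequency k s * x) := by
      fun_prop (disch := assumption)
    rw [intervalIntegral.integral_congr fun x _ => h1 x, intervalIntegral.integral_sub
      (Continuous.intervalIntegrable (by fun_prop) _ _)
      (Continuous.intervalIntegrable (by fun_prop) _ _),
      intervalIntegral.integral_mul_const, intervalIntegral.integral_ofReal,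
      intervalIntegral.integral_ofReal, integral_jacobiCn_mul_sin hk0 hk1,
      integral_jacobiCn_mul_cos hk0 hk1 hl0 hl1 hkl (cos_cnFrequency hk0 hk1 s), cnWeight_eq_cosh,
      ofReal_zero, zero_mul, sub_zero, Complex.real_smul, ← ofReal_mul]
    congr 1
    have := Real.cosh_pos (cnFrequency k s * ellipticK (Real.sqrt (1 - k ^ 2)))
    field_simp
  -- Summable coefficients and continuity give convergence at every point, as is needed at the
  -- specific arguments `w(i-j)`.
  have hsum : Summable (fourierCoeff f) := by
    rw [funext hcoef]
    exact ofRealCLM.summable (summable_cnWeight hk0 hk1)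
  have h := (has_pointwise_sum_fourier_series_of_summable hsum (u : AddCircle (2 * ellipticK k))).mul_left
    (exp (-(Real.pi * u / (2 * ellipticK k) * I)))
  rw [hf] at h
  simp only [hg, hcoef, fourier_coe_apply, smul_eq_mul] at h
  rw [mul_left_comm, ← exp_add, neg_add_cancel, exp_zero, mul_one] at h
  refine (congrArg (HasSum · _) (funext fun s => ?_)).mpr h
  rw [mul_left_comm, ← exp_add]
  congr 2
  rw [cnFrequency]
  push_cast
  field_simp
  ring

theorem cnPoint_eq (s : ℤ) :
    cnPoint k w s = Complex.exp (cnFrequency k s * w * Complex.I) := by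
  rw [cnPoint, cnFrequency]
  congr 1
  push_cast
  ring

theorem aeval_cnPoly (n : ℕ) (z : ℂ) : aeval z (cnPoly k w n) =
    ∑ i ∈ Finset.range (n + 1), (cnCoeff k w n i : ℂ) * z ^ i := by
  simp [cnPoly]

theorem cnPoint_pow_mul_one_div_pow (s : ℤ) (i j : ℕ) :
    cnPoint k w s ^ i * (1 / cnPoint k w s) ^ j =
      Complex.exp (cnFrequency k s * ((w * ((i : ℝ) - j) : ℝ) : ℂ) * Complex.I) := by
  rw [cnPoint_eq, one_div, ← Complex.exp_neg, ← Complex.exp_nat_mul, ← Complex.exp_nat_mul,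
    ← Complex.exp_add]
  congr 1
  push_cast
  ring

/-- A finite combination of the Fourier series at `u = w(i-j)`. In `ℂ`, `HasSum` over `ℤ` includes
absolute convergence. -/
theorem hasSum_cnPoly_mul_cnPoly (hk0 : 0 < k) (hk1 : k < 1)
    (hs : ∀ n : ℕ, jacobiSn k (w * ((n : ℝ) + 1)) ≠ 0) (n m : ℕ) :
    HasSum (fun s : ℤ => (cnWeight k s : ℂ) * aeval (cnPoint k w s) (cnPoly k w n) *
        aeval (1 / cnPoint k w s) (cnPoly k w m))
      (if n = m then (cnNorm k w n : ℂ) else 0) := by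
  have h := hasSum_sum (s := Finset.range (n + 1)) fun i _ =>
    hasSum_sum (s := Finset.range (m + 1)) fun j _ =>
      (hasSum_jacobiCn hk0 hk1 (w * ((i : ℝ) - j))).mul_left
        ((cnCoeff k w n i * cnCoeff k w m j : ℝ) : ℂ)
  have e := congrArg (fun x : ℝ => (x : ℂ)) (sum_cnCoeff_mul_jacobiCn hk0 hk1 hs n m)
  simp only [apply_ite (fun x : ℝ => (x : ℂ)), Complex.ofReal_zero] at e
  rw [← e]
  simp only [Complex.ofReal_sum, Complex.ofReal_mul] at h ⊢
  refine (congrArg (HasSum · _) (funext fun s => ?_)).mpr h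
  rw [aeval_cnPoly, aeval_cnPoly, mul_assoc, Finset.sum_mul_sum, Finset.mul_sum]
  refine Finset.sum_congr rfl fun i _ => ?_
  rw [Finset.mul_sum]
  refine Finset.sum_congr rfl fun j _ => ?_
  rw [mul_mul_mul_comm, cnPoint_pow_mul_one_div_pow]
  push_cast
  ring

end Orthogonality

/-! ### Consequences of genericity: nonvanishing, distinctness and density. -/

section Density

variable {k w : ℝ}

theorem norm_cnPoint (s : ℤ) : ‖cnPoint k w s‖ = 1 := by
  rw [cnPoint_eq, ← Complex.ofReal_mul, Complex.norm_exp_ofReal_mul_I]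

theorem jacobiSn_mul_ne_zero (hk0 : 0 < k) (hk1 : k < 1) (hw0 : w ≠ 0)
    (hw : ∀ M₁ M₂ : ℤ, M₁ ≠ 0 → M₂ ≠ 0 → w ≠ 4 * ellipticK k * M₁ / M₂) (n : ℕ) :
    jacobiSn k (w * ((n : ℝ) + 1)) ≠ 0 := by
  rw [Ne, jacobiSn_eq_zero_iff hk0 hk1]
  rintro ⟨m, hm⟩
  have hn : (n : ℝ) + 1 ≠ 0 := by positivity
  have hm0 : m ≠ 0 := by
    rintro rfl
    simp [hw0, hn] at hm
  -- A zero means `w(n+1) = 2Km`, that is `w = 4Km/(2(n+1))`.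
  refine hw m (2 * ((n : ℤ) + 1)) hm0 (by positivity) ?_
  push_cast
  field_simp
  linarith

theorem irrational_div_two_ellipticK (hk0 : 0 < k) (hk1 : k < 1) (hw0 : w ≠ 0)
    (hw : ∀ M₁ M₂ : ℤ, M₁ ≠ 0 → M₂ ≠ 0 → w ≠ 4 * ellipticK k * M₁ / M₂) :
    Irrational (w / (2 * ellipticK k)) := by
  have hK := ellipticK_pos hk0 hk1
  rintro ⟨r, hr⟩
  rw [eq_div_iff (by positivity)] at hr
  have hr0 : r ≠ 0 := by
    rintro rfl
    simp at hr
    exact hw0 hr.symm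
  refine hw r.num (2 * r.den) (Rat.num_ne_zero.2 hr0) (by positivity) ?_
  rw [← hr, Rat.cast_def]
  push_cast
  have : (r.den : ℝ) ≠ 0 := by positivity
  field_simp
  norm_num

/-- A coincidence `z_s = z_t` would give `w/(2K) = m/(s-t)`. -/
theorem cnPoint_injective (hk0 : 0 < k) (hk1 : k < 1)
    (hirr : Irrational (w / (2 * ellipticK k))) : Function.Injective (cnPoint k w) := by
  intro s t hst
  by_contra hne
  have hK := ellipticK_pos hk0 hk1
  rw [cnPoint_eq, cnPoint_eq, Complex.exp_eq_exp_iff_exists_int] at hst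
  obtain ⟨m, hm⟩ := hst
  have h1 : cnFrequency k s * w = cnFrequency k t * w + m * (2 * Real.pi) := by
    have : ((cnFrequency k s * w : ℝ) : ℂ) * Complex.I =
        ((cnFrequency k t * w + m * (2 * Real.pi) : ℝ) : ℂ) * Complex.I := by
      push_cast
      rw [hm]
      ring
    exact_mod_cast mul_right_cancel₀ Complex.I_ne_zero this
  have hd : (s : ℝ) - t ≠ 0 := by
    rw [sub_ne_zero]
    exact_mod_cast hne
  refine hirr ⟨(m : ℚ) / ((s : ℚ) - t), ?_⟩
  push_cast
  rw [div_eq_div_iff hd (by positivity)]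
  simp only [cnFrequency] at h1
  have hpi := Real.pi_ne_zero
  field_simp at h1
  linarith

/-- On the circle of length `2K` the multiples of `w` are dense because `w/(2K)` is irrational. The
points `z_s` are their images under `h`, which includes the shift by `w/2`. -/
theorem closure_range_cnPoint (hk0 : 0 < k) (hk1 : k < 1)
    (hirr : Irrational (w / (2 * ellipticK k))) :
    closure (Set.range (cnPoint k w)) = Metric.sphere (0 : ℂ) 1 := by
  have hK := ellipticK_pos hk0 hk1
  have : Fact (0 < 2 * ellipticK k) := ⟨by positivity⟩
  refine Set.Subset.antisymm (closure_minimal ?_ Metric.isClosed_sphere) fun z hz => ?_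
  · rintro _ ⟨s, rfl⟩
    simpa using norm_cnPoint s
  · set h : AddCircle (2 * ellipticK k) → ℂ := fun x =>
      (AddCircle.toCircle (x - ((w / 2 : ℝ) : AddCircle (2 * ellipticK k))) : ℂ) with hh
    have hcont : Continuous h := by
      have := AddCircle.continuous_toCircle (T := 2 * ellipticK k)
      simp only [hh]
      fun_prop
    have hpt : ∀ s : ℤ, h (s • (w : AddCircle (2 * ellipticK k))) = cnPoint k w s := fun s => by
      simp only [hh]
      rw [← AddCircle.coe_zsmul, ← AddCircle.coe_sub, AddCircle.toCircle_apply_mk,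
        Circle.coe_exp, cnPoint_eq, cnFrequency]
      congr 1
      have hKc : (ellipticK k : ℂ) ≠ 0 := Complex.ofReal_ne_zero.2 hK.ne'
      simp only [zsmul_eq_mul]
      push_cast
      field_simp
    obtain ⟨y, hy⟩ := (AddCircle.homeomorphCircle (T := 2 * ellipticK k) (by positivity)).surjective
      ⟨z, hz⟩
    have hz' : z = h (y + ((w / 2 : ℝ) : AddCircle (2 * ellipticK k))) := by
      simp only [hh, add_sub_cancel_right]
      rw [← AddCircle.homeomorphCircle_apply (by positivity), hy]
    have hdense := AddCircle.denseRange_zsmul_coe_iff.2 hirr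
    rw [hz']
    have := map_mem_closure hcont (hdense (y + ((w / 2 : ℝ) : AddCircle (2 * ellipticK k))))
      (t := Set.range (cnPoint k w)) (by
        rintro _ ⟨s, rfl⟩
        exact ⟨s, (hpt s).symm⟩)
    exact this

theorem exists_cnPoint_near (hcl : closure (Set.range (cnPoint k w)) = Metric.sphere (0 : ℂ) 1)
    (s : ℤ) (ε : ℝ) (hε : 0 < ε) :
    ∃ s' : ℤ, cnPoint k w s' ≠ cnPoint k w s ∧ ‖cnPoint k w s - cnPoint k w s'‖ < ε := by
  -- The auxiliary point `p` is `z_s` turned by `δ`; `δ ≤ 1 < π` ensures `p ≠ z_s`.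
  set δ := min (ε / 2) 1 with hδ
  have hδ0 : 0 < δ := lt_min (by linarith) one_pos
  set p := cnPoint k w s * Complex.exp (Complex.I * δ) with hp
  have hdist : dist p (cnPoint k w s) ≤ ε / 2 := by
    rw [dist_eq_norm, hp, ← mul_sub_one, norm_mul, norm_cnPoint, one_mul]
    refine (Real.norm_exp_I_mul_ofReal_sub_one_le).trans ?_
    rw [Real.norm_eq_abs, abs_of_pos hδ0]
    exact min_le_left _ _
  have hne : p ≠ cnPoint k w s := fun h => by
    have hz : cnPoint k w s ≠ 0 := norm_ne_zero_iff.1 (by rw [norm_cnPoint]; exact one_ne_zero)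
    have h1 := mul_left_cancel₀ hz (h.trans (mul_one _).symm)
    have h2 := congrArg Complex.im h1
    rw [mul_comm, Complex.exp_ofReal_mul_I_im, Complex.one_im] at h2
    have h3 := Real.sin_pos_of_pos_of_lt_pi hδ0
      ((min_le_right _ _).trans_lt (by linarith [Real.pi_gt_three]))
    exact h3.ne' h2
  have hmem : p ∈ closure (Set.range (cnPoint k w)) := by
    rw [hcl, mem_sphere_zero_iff_norm, hp, norm_mul, norm_cnPoint, one_mul, mul_comm,
      Complex.norm_exp_ofReal_mul_I]
  -- Approximating `p` more closely than `z_s` does forces `z_{s'} ≠ z_s`.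
  obtain ⟨_, ⟨s', rfl⟩, hs'⟩ := Metric.mem_closure_iff.1 hmem _ (dist_pos.2 hne)
  refine ⟨s', fun h => ?_, ?_⟩
  · rw [h] at hs'
    exact lt_irrefl _ hs'
  · rw [← dist_eq_norm]
    calc _ ≤ dist (cnPoint k w s) p + dist p (cnPoint k w s') := dist_triangle _ _ _
      _ < ε := by rw [dist_comm]; linarith

end Density

/-! ### Size and explicit values of the reflection parameters. -/

section ReflectionBounds

variable {k w : ℝ}

/-- Since `sn(w(n+1)) ≠ 0`, both `cn² = 1 - sn²` and `dn² = 1 - k² sn²` are below `1` there. -/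
theorem abs_cnReflection_lt_one (hk0 : 0 < k) (hk1 : k < 1)
    (hs : ∀ n : ℕ, jacobiSn k (w * ((n : ℝ) + 1)) ≠ 0) (n : ℕ) : |cnReflection k w n| < 1 := by
  have hsq : 0 < jacobiSn k (w * ((n : ℝ) + 1)) ^ 2 := by
    have := hs n
    positivity
  rw [← sq_lt_one_iff_abs_lt_one, cnReflection]
  split_ifs
  · rw [jacobiCn_sq]
    linarith
  · rw [neg_sq, jacobiDn_sq hk0 hk1]
    have : 0 < k ^ 2 * jacobiSn k (w * ((n : ℝ) + 1)) ^ 2 := by positivity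
    linarith

theorem cnReflection_values (n : ℕ) :
    cnReflection k w (2 * n) = jacobiCn k (w * (2 * (n : ℝ) + 1)) ∧
      cnReflection k w (2 * n + 1) = -jacobiDn k (w * (2 * (n : ℝ) + 2)) := by
  constructor
  · rw [cnReflection, if_pos (even_two_mul n)]
    push_cast
    rfl
  · rw [cnReflection, if_neg (Nat.not_even_iff_odd.2 (odd_two_mul_add_one n))]
    congr 3
    push_cast
    ring

end ReflectionBounds
theorem theorem1 (k w : ℝ) (hk0 : 0 < k) (hk1 : k < 1) (hw0 : w ≠ 0)
    (hw : ∀ M₁ M₂ : ℤ, M₁ ≠ 0 → M₂ ≠ 0 → w ≠ 4 * ellipticK k * M₁ / M₂) :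
    -- monic polynomials of degree `n`
    (∀ n : ℕ, (cnPoly k w n).Monic ∧ (cnPoly k w n).natDegree = n) ∧
    -- the reflection parameters, and the values they take
    (∃ a : ℕ → ℝ, IsReflectionParameters (cnPoly k w) a ∧
      (∀ n : ℕ, a (2 * n) = jacobiCn k (w * (2 * (n : ℝ) + 1)) ∧
        a (2 * n + 1) = -jacobiDn k (w * (2 * (n : ℝ) + 2))) ∧
      ∀ n : ℕ, -1 < a n ∧ a n < 1) ∧
    -- pairwise distinct points on the unit circle, with positive weights
    (∀ s : ℤ, ‖cnPoint k w s‖ = 1) ∧ Function.Injective (cnPoint k w) ∧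
    (∀ s : ℤ, 0 < cnWeight k s) ∧
    -- orthogonality
    (∀ n m : ℕ, HasSum
      (fun s : ℤ => (cnWeight k s : ℂ) * aeval (cnPoint k w s) (cnPoly k w n) *
        aeval (1 / cnPoint k w s) (cnPoly k w m))
      (if n = m then (cnNorm k w n : ℂ) else 0)) ∧
    -- positivity of the normalization constants
    (∀ n : ℕ, 0 < cnNorm k w n) ∧
    -- density of the points: in the unit circle, and no point is isolated from the others
    closure (Set.range (cnPoint k w)) = Metric.sphere (0 : ℂ) 1 ∧
    (∀ s : ℤ, ∀ ε : ℝ, 0 < ε → ∃ s' : ℤ,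
      cnPoint k w s' ≠ cnPoint k w s ∧ ‖cnPoint k w s - cnPoint k w s'‖ < ε) := by
  have hs := jacobiSn_mul_ne_zero hk0 hk1 hw0 hw
  have hirr := irrational_div_two_ellipticK hk0 hk1 hw0 hw
  have hcl := closure_range_cnPoint hk0 hk1 hirr
  exact ⟨fun n => ⟨monic_cnPoly hk0 hk1 hs n, natDegree_cnPoly hk0 hk1 hs n⟩,
    ⟨cnReflection k w, isReflectionParameters_cnPoly hk0 hk1 hs, cnReflection_values,
      fun n => abs_lt.1 (abs_cnReflection_lt_one hk0 hk1 hs n)⟩,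
    norm_cnPoint, cnPoint_injective hk0 hk1 hirr, cnWeight_pos hk0 hk1,
    hasSum_cnPoly_mul_cnPoly hk0 hk1 hs, cnNorm_pos hk0 hs, hcl, exists_cnPoint_near hcl⟩
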